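/- Let $G$ be a finite group and let $k$ be a field of characteristic $0$ that is a splitting field for $G$ (every irreducible representation of $G$ over an algebraic closure of $k$ is defined over $k$). Let $\mathrm{FI}_G$ be the category with objects $[n]=\{1,\dots,n\}$, $n\ge 0$, whose morphisms $[m]\to[n]$ are pairs $(a,(g_i)_{i\in[m]})$ with $a:[m]\to[n]$ injective and $g_i\in G$, with composition $(b,(h_j))\circ(a,(g_i))=(b\circ a,(g_i h_{a(i)}))$; put $W_n=\mathrm{Aut}([n])=G^n\rtimes S_n$. An $\mathrm{FI}_G$-module $V$ over $k$ is a functor from $\mathrm{FI}_G$ to $k$-modules, and $V_n=V([n])$. It is finitely generated if some finite set of elements $v\in V_{n_v}$ is contained in no proper $\mathrm{FI}_G$-submodule, and generated in degree $\le d$ if the elements of all $V_j$ with $j\le d$ are contained in no proper $\mathrm{FI}_G$-submodule. For a representation $A$ of $W_d$, the induced $\mathrm{FI}_G$-module is $\mathrm{Ind}(A)_n=k[\mathrm{Hom}([d],[n])]\otimes_{k[W_d]}A$; a relatively projective $\mathrm{FI}_G$-module is a direct sum of (possibly infinitely many) induced ones. $V$ is related in degree $\le r$ if there is an exact sequence $0\to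 K\to M\to V\to 0$ of $\mathrm{FI}_G$-modules with $M$ relatively projective and $K$ generated in degree $\le r$. For $w=(a,(g_i))\in W_n$, a cycle of $w$ is a cycle $(x,a(x),\dots,a^{l-1}(x))$ of the permutation $a$ (fixed points included); its label is the conjugacy class in $G$ of $g_x g_{a(x)}\cdots g_{a^{l-1}(x)}$. For $i\ge 1$ and a conjugacy class $C$ of $G$, let $X_i^C(w)$ be the number of cycles of $w$ of length $i$ with label $C$. Theorem. Let $V$ be a finitely generated $\mathrm{FI}_G$-module over $k$ that is generated in degree $\le m$ and related in degree $\le r$. Then every $V_n$ is finite-dimensional, and there is a polynomial $$P_V\in k\left[\{X_i^C \mid i\ge 1,\ C \text{ a conjugacy class of } G\}\right]$$ of degree $\le m$, both for the grading in which $X_i^C$ has degree $i$ and (consequently) for the usual total degree, such that for all $n\ge r+\min(m,r)$ and all $w\in W_n$ the character $\chi_{V_n}(w)$ equals the value of $P_V$ at the numbers $X_i^C(w)$. In particular there is a polynomial $Q\in\mathbb{Q}[T]$ of degree $\le m$ with $\dim_k V_n=Q(n)$ for all $n\ge r+\min(m,r)$. -/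

import Mathlib

open CategoryTheory

universe u

/-! ## The category `FI_G` (on the objects `[n]`) -/

/-- The objects of `FI_G`: the object `FIG.of n` stands for the finite set `[n]`, modelled
by `Fin n`. -/
structure FIG (G : Type u) where
  /-- the object `[n]` -/
  of ::
  /-- the number of elements -/
  card : ℕ

namespace FIG

variable {G : Type u}

/-- A morphism `[m] → [n]` of `FI_G`: an injection `a`, and an element of `G` for every
element of the source. -/
@[ext]
structure Hom (X Y : FIG G) where
  /-- the underlying injection -/
  emb : Fin X.card ↪ Fin Y.card
  /-- the labels -/
  label : Fin X.card → G

/-- The composition is `(b, h) ∘ (a, g) = (b ∘ a, (g i * h (a i))_i)`. -/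
instance [Group G] : Category (FIG G) where
  Hom := Hom
  id X := ⟨Function.Embedding.refl _, fun _ => 1⟩
  comp f f' := ⟨f.emb.trans f'.emb, fun i => f.label i * f'.label (f.emb i)⟩
  id_comp f := by
    apply Hom.ext
    · rfl
    · funext i; exact one_mul _
  comp_id f := by
    apply Hom.ext
    · rfl
    · funext i; exact mul_one _
  assoc f f' f'' := by
    apply Hom.ext
    · rfl
    · funext i; exact mul_assoc _ _ _

end FIG

/-- The wreath product `W_n = G ≀ S_n`, as the automorphism group of `[n]` in `FI_G`. -/
abbrev FIG.W (G : Type u) [Group G] (n : ℕ) : Type u := Aut (FIG.of n : FIG G)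

/-- An `FI_G`-module over `k` is a functor from `FI_G` to `k`-modules. -/
abbrev FIGModule (G k : Type u) [Group G] [Field k] := FIG G ⥤ ModuleCat.{u} k

namespace FIGModule

variable {G k : Type u} [Group G] [Field k]

/-- The degree `n` part of the `FI_G`-submodule of `V` generated by a set `S` of (homogeneous)
elements: the span of all `f_* x` with `x ∈ S` in degree `j` and `f : [j] → [n]`. -/
def generated (V : FIGModule G k) (S : Set (Σ j : ℕ, V.obj (FIG.of j))) (n : ℕ) :
    Submodule k (V.obj (FIG.of n)) :=
  Submodule.span k {y | ∃ (j : ℕ) (x : V.obj (FIG.of j)) (f : (FIG.of j : FIG G) ⟶ FIG.of n),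
    (⟨j, x⟩ : Σ j : ℕ, V.obj (FIG.of j)) ∈ S ∧ y = (V.map f).hom x}

/-- `V` is finitely generated: some finite set of elements generates all of `V`. -/
def IsFinitelyGenerated (V : FIGModule G k) : Prop :=
  ∃ S : Set (Σ j : ℕ, V.obj (FIG.of j)), S.Finite ∧ ∀ n, V.generated S n = ⊤

/-- `V` is generated in degree `≤ d`: the elements of degree `≤ d` generate all of `V`. -/
def IsGeneratedInDegree (V : FIGModule G k) (d : ℕ) : Prop :=
  ∀ n, V.generated {p | p.1 ≤ d} n = ⊤

/-- The relations `(f ∘ w) ⊗ x = f ⊗ (w x)` for `w ∈ W_d`, `f : [d] → [n]`, `x ∈ A`, in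
`k[Hom([d], [n])] ⊗ A`, the latter being realised as finitely supported functions from
`Hom([d], [n])` to `A`. -/
noncomputable def indRel {d : ℕ} (A : Rep.{u} k (FIG.W G d)) (X : FIG G) :
    Submodule k (((FIG.of d : FIG G) ⟶ X) →₀ A) :=
  Submodule.span k {z | ∃ (w : FIG.W G d) (f : (FIG.of d : FIG G) ⟶ X) (x : A),
    z = Finsupp.single (w.hom ≫ f) x - Finsupp.single f (A.ρ w x)}

/-- Composition with `h : X → Y` sends the relations over `X` into those over `Y`. -/
theorem indRel_le_comap {d : ℕ} (A : Rep.{u} k (FIG.W G d)) {X Y : FIG G} (h : X ⟶ Y) :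
    indRel A X ≤ (indRel A Y).comap
      (Finsupp.lmapDomain A k (fun f : (FIG.of d : FIG G) ⟶ X => f ≫ h)) := by
  refine Submodule.span_le.2 ?_
  rintro z ⟨w, f, x, rfl⟩
  refine Submodule.subset_span ⟨w, f ≫ h, x, ?_⟩
  rw [map_sub]
  simp [Finsupp.lmapDomain_apply, Finsupp.mapDomain_single]

/-- The induced `FI_G`-module of a representation `A` of `W_d`,
in degree `n` given by `k[Hom([d], [n])] ⊗_{k[W_d]} A`. For `n = d + j` this is
`Ind_{W_d × W_j}^{W_n} (A ⊠ k)` because `Hom([d], [n]) = W_n / W_j`, and it vanishes for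
`n < d`. -/
noncomputable def ind {d : ℕ} (A : Rep.{u} k (FIG.W G d)) : FIGModule G k where
  obj X := ModuleCat.of k ((((FIG.of d : FIG G) ⟶ X) →₀ A) ⧸ indRel A X)
  map {X Y} h := ModuleCat.ofHom (Submodule.mapQ (indRel A X) (indRel A Y)
    (Finsupp.lmapDomain A k (fun f : (FIG.of d : FIG G) ⟶ X => f ≫ h)) (indRel_le_comap A h))
  map_id X := by
    refine ModuleCat.hom_ext (Submodule.linearMap_qext _ (Finsupp.lhom_ext fun f x => ?_))
    simp [Finsupp.lmapDomain_apply, Finsupp.mapDomain_single]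
  map_comp {X Y Z} h h' := by
    refine ModuleCat.hom_ext (Submodule.linearMap_qext _ (Finsupp.lhom_ext fun f x => ?_))
    simp [Finsupp.lmapDomain_apply, Finsupp.mapDomain_single]

open Classical in
/-- `M` is relatively projective: it is a (possibly infinite) direct sum of induced modules
`ind (A a)`, where `A a` is a representation of `W_{d a}`. -/
def IsRelativelyProjective (M : FIGModule G k) : Prop :=
  ∃ (ι : Type u) (d : ι → ℕ) (A : ∀ a, Rep.{u} k (FIG.W G (d a)))
    (incl : ∀ a, ind (A a) ⟶ M), ∀ X : FIG G,
      Function.Bijective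
        (DirectSum.toModule k ι (M.obj X) (fun a => ((incl a).app X).hom))

/-- `V` is related in degree `≤ r`: there is an exact sequence `0 → K → M → V → 0` of
`FI_G`-modules with `M` relatively projective and `K` generated in degree `≤ r`. -/
def IsRelatedInDegree (V : FIGModule G k) (r : ℕ) : Prop :=
  ∃ (K M : FIGModule G k) (i : K ⟶ M) (p : M ⟶ V),
    (∀ X, Function.Injective (i.app X).hom) ∧
    (∀ X, Function.Exact (i.app X).hom (p.app X).hom) ∧
    (∀ X, Function.Surjective (p.app X).hom) ∧
    M.IsRelativelyProjective ∧ K.IsGeneratedInDegree r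

/-- The character of the `W_n`-representation `V_n`. -/
noncomputable def character (V : FIGModule G k) (n : ℕ) (w : FIG.W G n) : k :=
  LinearMap.trace k (V.obj (FIG.of n)) (V.map w.hom).hom

end FIGModule

/-! ## Labelled cycle counts -/

namespace FIG

variable {G : Type u} [Group G]

/-- The label of the cycle of `w = (a, g) ∈ W_n` through `x`: the conjugacy class of
`g x * g (a x) * ⋯ * g (a^(l-1) x)`, where `l` is the length of the cycle. -/
noncomputable def cycleLabel {n : ℕ} (w : W G n) (x : Fin n) : ConjClasses G :=
  ConjClasses.mk ((List.range (Function.minimalPeriod w.hom.emb x)).map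
    (fun j => w.hom.label (w.hom.emb^[j] x))).prod

/-- `X_i^C (w)`: the number of cycles (fixed points included) of `w = (a, g) ∈ W_n` that have
length `i` and label `C`; a cycle is regarded as the orbit of one of its elements under `a`. -/
noncomputable def cycleCount {n : ℕ} (w : W G n) (i : ℕ) (C : ConjClasses G) : ℕ :=
  Set.ncard {c : Set (Fin n) | ∃ x : Fin n, c = {y | ∃ j : ℕ, w.hom.emb^[j] x = y} ∧
    Function.minimalPeriod w.hom.emb x = i ∧ cycleLabel w x = C}

end FIG

/-- `k` is a splitting field for `G` (used in characteristic `0`): every irreducible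
finite-dimensional representation of `G` over the algebraic closure of `k` is defined over `k`,
that is, has a basis in which all matrix entries lie in `k`. -/
def IsSplittingFieldOfGroup (k G : Type u) [Field k] [Group G] : Prop :=
  ∀ (U : Type u) [AddCommGroup U] [Module (AlgebraicClosure k) U]
    [FiniteDimensional (AlgebraicClosure k) U] (ρ : Representation (AlgebraicClosure k) G U),
    ρ.IsIrreducible →
      ∃ (d : ℕ) (b : Module.Basis (Fin d) (AlgebraicClosure k) U),
        ∀ (g : G) (i j : Fin d),
          LinearMap.toMatrix b b (ρ g) i j ∈ (algebraMap k (AlgebraicClosure k)).range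

/-!
For `u ∈ W_a` and `w ∈ W_n`, let `B_u(w)` be the number of morphisms `f : [a] → [n]` with
`u ≫ f = f ≫ w` (`FIG.eqCount`). The proof expresses the characters by these functions.

*They are polynomials in the cycle counts.* For a cycle `u` of length `l` with label `C ∋ h`, the
number `B_u(w)` is `l` times the order of the centralizer of `h` times `X_l^C(w)`
(`FIG.eqCount_stdCycle`). In general, `u` is the disjoint union of some `u'` and a cycle `c`, and a
morphism from `c` that intertwines it with `w` either avoids a given equivariant copy of `u'` or is
contained in it, so that `B_u = B_{u'} (B_c - B_c(u'))` (`FIG.eqCount_add_mul`).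

*For fixed `n`, they span the possible characters.* If `U` is generated in degree `≤ s`, the
character of `U_n` is a combination of the `B_u` with `u ∈ W_a`, `a ≤ s`
(`FIGModule.character_mem_countSpan`). Indeed `U_n` is the sum of the images of the maps `U(f)`
with `f : [j] → [n]`, `j ≤ s`; writing the identity in terms of these and averaging over
conjugation by `W_n` expresses the character by numbers of morphisms that are equivariant on a part
of their source, and such numbers are reduced to the `B_u` by induction.

*The coefficients do not depend on `n`.* The scalar product of `B_u` and the character of `U_n` is
the average over `W_n` of the traces on `U_n ⊗ k[Hom([a], [n])]`, that is, a trace on the coinvariants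
of this representation. From `n` to `n + 1` the coinvariants do not change if the natural map
between them is bijective. It is surjective for `n ≥ s + a`. It is injective if `U` is a relatively
projective module, hence for `n ≥ r + a` if `U` is related in degree `≤ r`, and (averaging over `W_n`)
also if `U` is contained in such a module. The same applies to the free modules `k[Hom([b], -)]`, which
gives the stability of the scalar products of `B_u` and `B_v`. Two combinations of the `B_u` with equal
scalar products with all `B_v` are equal, because the `B_u` have values in the natural numbers
(`sum_mul_natCast_eq_zero`). So the character of `U_n` is given by a polynomial of degree `≤ s` for
`n ≥ r + s`, provided that `s ≤ r` (`FIGModule.exists_cyclePoly_character`).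

*The general case.* Apply this to the submodule `U` of `V` generated by the elements of degree
`≤ s = min m r`. If `m ≤ r`, this is `V`. Otherwise let `0 → K → M → V → 0` be a presentation, with
`K` generated in degree `≤ r` and `M` a direct sum of modules `ind A`. The summands with `A` in degree
`d > r` vanish in degrees `≤ r`, hence the projections of `M` to them vanish on `K`. So they are direct
summands of `V` with complement `U`; there are finitely many nonzero ones, and they have `d ≤ m`
(`FIGModule.IsRelatedInDegree.exists_ind_summands`). The character of `ind A` is a combination of the
`B_u` with `u ∈ W_d` (`FIGModule.trace_ind_map`).

The dimension of `V_n` is the value of the character at the identity, which has `n` cycles of length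
`1` with trivial label, and no others.
-/

namespace FIG

/-! ### Morphisms of `FI_G` -/

section Basic

variable {G : Type u} [Group G]

@[simp] theorem comp_emb {X Y Z : FIG G} (f : X ⟶ Y) (g : Y ⟶ Z) (i : Fin X.card) :
    (f ≫ g).emb i = g.emb (f.emb i) := rfl

@[simp] theorem comp_label {X Y Z : FIG G} (f : X ⟶ Y) (g : Y ⟶ Z) (i : Fin X.card) :
    (f ≫ g).label i = f.label i * g.label (f.emb i) := rfl

@[simp] theorem id_emb (X : FIG G) (i : Fin X.card) : (𝟙 X : X ⟶ X).emb i = i := rfl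

@[simp] theorem id_label (X : FIG G) (i : Fin X.card) : (𝟙 X : X ⟶ X).label i = 1 := rfl

theorem hom_ext' {X Y : FIG G} {f g : X ⟶ Y} (h : ∀ i, f.emb i = g.emb i)
    (h' : ∀ i, f.label i = g.label i) : f = g :=
  Hom.ext (Function.Embedding.ext h) (funext h')

theorem hom_ext_iff {X Y : FIG G} {f g : X ⟶ Y} :
    f = g ↔ (∀ i, f.emb i = g.emb i) ∧ ∀ i, f.label i = g.label i :=
  ⟨by rintro rfl; simp, fun h => hom_ext' h.1 h.2⟩

/-- Every morphism of `FI_G` is a monomorphism. -/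
theorem cancel_right {X Y Z : FIG G} {f g : X ⟶ Y} {h : Y ⟶ Z} (e : f ≫ h = g ≫ h) : f = g := by
  rw [hom_ext_iff] at e
  have h1 : ∀ i, f.emb i = g.emb i := fun i => h.emb.injective (e.1 i)
  refine hom_ext' h1 fun i => ?_
  have := e.2 i
  simp only [comp_label, h1] at this
  exact mul_right_cancel this

theorem card_le_of_hom {X Y : FIG G} (f : X ⟶ Y) : X.card ≤ Y.card := by
  simpa using Fintype.card_le_of_embedding f.emb

instance [Finite G] (X Y : FIG G) : Finite (X ⟶ Y) :=
  Finite.of_injective (fun f : X ⟶ Y => ((f.emb : Fin X.card → Fin Y.card), f.label))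
    fun f g h => by
      simp only [Prod.mk.injEq] at h
      exact hom_ext' (fun i => congrFun h.1 i) (fun i => congrFun h.2 i)

noncomputable instance [Finite G] (X Y : FIG G) : Fintype (X ⟶ Y) := Fintype.ofFinite _

instance [Finite G] (n : ℕ) : Finite (W G n) :=
  Finite.of_injective (fun w : W G n => w.hom) fun _ _ h => Iso.ext h

noncomputable instance [Finite G] (n : ℕ) : Fintype (W G n) := Fintype.ofFinite _

theorem emb_bijective {n : ℕ} (f : (FIG.of n : FIG G) ⟶ FIG.of n) : Function.Bijective f.emb :=
  Finite.injective_iff_bijective.1 f.emb.injective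

/-- An endomorphism of `[n]`, regarded as an element of `W_n`: all of them are invertible. -/
noncomputable def asAut {n : ℕ} (f : (FIG.of n : FIG G) ⟶ FIG.of n) : W G n where
  hom := f
  inv := ⟨(Equiv.ofBijective f.emb (emb_bijective f)).symm.toEmbedding, fun i =>
      (f.label ((Equiv.ofBijective f.emb (emb_bijective f)).symm i))⁻¹⟩
  hom_inv_id := by
    have h := (Equiv.ofBijective f.emb (emb_bijective f)).symm_apply_apply
    refine hom_ext' h fun i => ?_
    have := h i
    simp only [Equiv.ofBijective_apply] at this
    simp [this]
  inv_hom_id :=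
    hom_ext' (Equiv.ofBijective f.emb (emb_bijective f)).apply_symm_apply fun i => by simp

@[simp] theorem asAut_hom {n : ℕ} (f : (FIG.of n : FIG G) ⟶ FIG.of n) : (asAut f).hom = f := rfl

theorem mul_hom {n : ℕ} (w w' : W G n) : (w * w').hom = w'.hom ≫ w.hom := rfl

theorem inv_hom {n : ℕ} (w : W G n) : (w⁻¹).hom = w.inv := rfl

theorem one_hom {n : ℕ} : (1 : W G n).hom = 𝟙 _ := rfl

@[simp] theorem aut_hom_inv_assoc {n : ℕ} {Y : FIG G} (w : W G n) (f : FIG.of n ⟶ Y) :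
    w.hom ≫ w.inv ≫ f = f := Iso.hom_inv_id_assoc w f

@[simp] theorem aut_inv_hom_assoc {n : ℕ} {Y : FIG G} (w : W G n) (f : FIG.of n ⟶ Y) :
    w.inv ≫ w.hom ≫ f = f := Iso.inv_hom_id_assoc w f

@[simp] theorem aut_hom_inv {n : ℕ} (w : W G n) : w.hom ≫ w.inv = 𝟙 _ := Iso.hom_inv_id w

@[simp] theorem aut_inv_hom {n : ℕ} (w : W G n) : w.inv ≫ w.hom = 𝟙 _ := Iso.inv_hom_id w

/-- The standard inclusion `[n] → [n + 1]`, with trivial labels. -/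
def incl (n : ℕ) : (FIG.of n : FIG G) ⟶ FIG.of (n + 1) := ⟨Fin.castSuccEmb, fun _ => 1⟩

@[simp] theorem incl_emb (n : ℕ) (i : Fin n) : (incl n : (FIG.of n : FIG G) ⟶ _).emb i = i.castSucc :=
  rfl

@[simp] theorem incl_label (n : ℕ) (i : Fin n) : (incl n : (FIG.of n : FIG G) ⟶ _).label i = 1 :=
  rfl

theorem exists_factor {X : FIG G} {n : ℕ} (f : X ⟶ FIG.of (n + 1))
    (h : ∀ i, f.emb i ≠ Fin.last n) : ∃ g : X ⟶ FIG.of n, f = g ≫ incl n :=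
  ⟨⟨⟨fun i => (f.emb i).castPred (h i), fun i j hij =>
      f.emb.injective ((Fin.castPred_inj).1 hij)⟩, f.label⟩,
    hom_ext' (fun _ => by simp; rfl) (fun _ => by simp)⟩

theorem incl_ne_last {X : FIG G} {n : ℕ} (g : X ⟶ FIG.of n) (i : Fin X.card) :
    (g ≫ incl n).emb i ≠ Fin.last n := (Fin.castSucc_lt_last (g.emb i)).ne

theorem exists_aut_emb_eq {n : ℕ} (x y : Fin n) : ∃ w : W G n, w.hom.emb x = y :=
  ⟨asAut ⟨(Equiv.swap x y).toEmbedding, fun _ => 1⟩, Equiv.swap_apply_left x y⟩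

/-- If the images of two morphisms to `[n + 1]` do not fill `[n + 1]`, an automorphism moves both
of them into `[n]`. -/
theorem exists_factor_pair {a b n : ℕ} (h : a + b ≤ n) (f : (FIG.of a : FIG G) ⟶ FIG.of (n + 1))
    (f' : (FIG.of b : FIG G) ⟶ FIG.of (n + 1)) :
    ∃ (w : W G (n + 1)) (g : FIG.of a ⟶ FIG.of n) (g' : FIG.of b ⟶ FIG.of n),
      f ≫ w.hom = g ≫ incl n ∧ f' ≫ w.hom = g' ≫ incl n := by
  have : ∃ x : Fin (n + 1), x ∉ Finset.univ.map f.emb ∪ Finset.univ.map f'.emb := by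
    by_contra! hx
    have h1 : (Finset.univ : Finset (Fin (n + 1))) ⊆ Finset.univ.map f.emb ∪ Finset.univ.map f'.emb :=
      fun x _ => hx x
    have h2 := (Finset.card_le_card h1).trans (Finset.card_union_le _ _)
    simp only [Finset.card_univ, Fintype.card_fin, Finset.card_map] at h2
    omega
  obtain ⟨x, hx⟩ := this
  simp only [Finset.mem_union, Finset.mem_map, Finset.mem_univ, true_and, not_or, not_exists] at hx
  obtain ⟨w, hw⟩ := exists_aut_emb_eq (G := G) x (Fin.last n)
  obtain ⟨g, hg⟩ := exists_factor (f ≫ w.hom) fun i hi =>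
    hx.1 i (w.hom.emb.injective (hi.trans hw.symm))
  obtain ⟨g', hg'⟩ := exists_factor (f' ≫ w.hom) fun i hi =>
    hx.2 i (w.hom.emb.injective (hi.trans hw.symm))
  exact ⟨w, g, g', hg, hg'⟩

/-- An element of `W_{n+1}` agrees with an element of `W_n` wherever it maps `[n]` to `[n]`. -/
theorem exists_aut_restrict {n : ℕ} (w : W G (n + 1)) : ∃ w' : W G n,
    ∀ (X : FIG G) (g h : X ⟶ FIG.of n), (g ≫ incl n) ≫ w.hom = h ≫ incl n → g ≫ w'.hom = h := by
  classical
  have hinj := w.hom.emb.injective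
  let ψ : (FIG.of n : FIG G) ⟶ FIG.of (n + 1) :=
    ⟨⟨fun x => if w.hom.emb (Fin.castSucc x) = Fin.last n then w.hom.emb (Fin.last n)
      else w.hom.emb (Fin.castSucc x), fun x y hxy => by
        have hx := (Fin.castSucc_lt_last x).ne
        have hy := (Fin.castSucc_lt_last y).ne
        dsimp only at hxy
        split_ifs at hxy with h1 h2 h2
        · exact Fin.castSucc_injective _ (hinj (h1.trans h2.symm))
        · exact absurd (hinj hxy) hy.symm
        · exact absurd (hinj hxy) hx
        · exact Fin.castSucc_injective _ (hinj hxy)⟩,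
      fun x => w.hom.label (Fin.castSucc x)⟩
  have hψ : ∀ x : Fin n, w.hom.emb x.castSucc ≠ Fin.last n → ψ.emb x = w.hom.emb x.castSucc :=
    fun x hx => if_neg hx
  obtain ⟨w', hw'⟩ := exists_factor ψ fun x hx => by
    by_cases h1 : w.hom.emb (Fin.castSucc x) = Fin.last n
    · have hx' : w.hom.emb (Fin.last n) = Fin.last n := (if_pos h1).symm.trans hx
      exact (Fin.castSucc_lt_last x).ne (hinj (h1.trans hx'.symm))
    · exact h1 ((hψ x h1).symm.trans hx)
  refine ⟨asAut w', fun X g h e => ?_⟩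
  have key : g ≫ ψ = (g ≫ incl n) ≫ w.hom := by
    refine hom_ext' (fun i => hψ (g.emb i) ?_) fun i => ?_
    · have := (hom_ext_iff.1 e).1 i
      exact fun h' => incl_ne_last h i (this.symm.trans h')
    · simp [ψ]
      rfl
  refine cancel_right (h := incl n) ?_
  rw [← e, ← key, hw', asAut_hom, Category.assoc]

theorem exists_aut_extend {n : ℕ} (w : W G n) :
    ∃ w' : W G (n + 1), w.hom ≫ incl n = incl n ≫ w'.hom := by
  let e : Equiv.Perm (Fin n) := Equiv.ofBijective w.hom.emb (emb_bijective w.hom)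
  refine ⟨asAut ⟨⟨fun x => Fin.lastCases (motive := fun _ => Fin (n + 1)) (Fin.last n)
      (fun i => (e i).castSucc) x, fun x y => ?_⟩,
    fun x => Fin.lastCases (motive := fun _ => G) 1 (fun i => w.hom.label i) x⟩, ?_⟩
  · cases x using Fin.lastCases <;> cases y using Fin.lastCases <;>
      simp [(Fin.castSucc_lt_last _).ne, (Fin.castSucc_lt_last _).ne']
  · refine hom_ext' (fun i => ?_) fun i => ?_
    · simp only [asAut_hom]
      exact (Fin.lastCases_castSucc (motive := fun _ => Fin (n + 1)) (i := i) ..).symm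
    · simp only [comp_label, asAut_hom]
      refine (mul_one _).trans ((Fin.lastCases_castSucc (motive := fun _ => G) (i := i) ..).symm.trans
        (one_mul _).symm)

end Basic

end FIG

/-! ### Traces -/

section LinearAlgebra

variable {k : Type*} [Field k]

/-- If `1 = ∑ ι_i ∘ p_i` on `V`, then `tr φ = ∑ tr (p_i ∘ φ ∘ ι_i)`. -/
theorem LinearMap.trace_eq_sum_of_sum_comp_eq_id {ι : Type*} [Fintype ι] {V : Type*}
    [AddCommGroup V] [Module k V] [Module.Finite k V] {N : ι → Type*} [∀ i, AddCommGroup (N i)]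
    [∀ i, Module k (N i)] [∀ i, Module.Finite k (N i)] (j : ∀ i, N i →ₗ[k] V)
    (p : ∀ i, V →ₗ[k] N i) (h : ∑ i, j i ∘ₗ p i = LinearMap.id) (φ : V →ₗ[k] V) :
    LinearMap.trace k V φ = ∑ i, LinearMap.trace k (N i) (p i ∘ₗ φ ∘ₗ j i) := by
  have : φ = ∑ i, (φ ∘ₗ j i) ∘ₗ p i := by
    conv_lhs => rw [← LinearMap.comp_id φ, ← h]
    ext x
    simp [map_sum]
  conv_lhs => rw [this, map_sum]
  exact Finset.sum_congr rfl fun i _ => LinearMap.trace_comp_comm' _ _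

/-- The linear map `X →₀ A` to `Y →₀ B` given by `θ : X → Y` and `α : A → B`. -/
noncomputable def Finsupp.lmapBoth {X Y A B : Type*} [AddCommGroup A] [Module k A] [AddCommGroup B]
    [Module k B] (θ : X → Y) (α : A →ₗ[k] B) : (X →₀ A) →ₗ[k] (Y →₀ B) :=
  Finsupp.lmapDomain B k θ ∘ₗ Finsupp.mapRange.linearMap α

@[simp] theorem Finsupp.lmapBoth_single {X Y A B : Type*} [AddCommGroup A] [Module k A]
    [AddCommGroup B] [Module k B] (θ : X → Y) (α : A →ₗ[k] B) (x : X) (a : A) :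
    Finsupp.lmapBoth θ α (Finsupp.single x a) = Finsupp.single (θ x) (α a) := by
  simp [Finsupp.lmapBoth, Finsupp.mapDomain_single]

theorem Finsupp.trace_lmapBoth {X A : Type*} [Finite X] [AddCommGroup A]
    [Module k A] [Module.Finite k A] (θ : X → X) (α : A →ₗ[k] A) :
    LinearMap.trace k (X →₀ A) (Finsupp.lmapBoth θ α) =
      Nat.card {x // θ x = x} * LinearMap.trace k A α := by
  classical
  have := Fintype.ofFinite X
  rw [LinearMap.trace_eq_sum_of_sum_comp_eq_id (fun x : X => Finsupp.lsingle (R := k) (M := A) x)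
    (fun x => Finsupp.lapply x)]
  · have : ∀ x : X, LinearMap.trace k A (Finsupp.lapply x ∘ₗ Finsupp.lmapBoth θ α ∘ₗ
        Finsupp.lsingle (R := k) (M := A) x) =
          if θ x = x then LinearMap.trace k A α else 0 := by
      intro x
      split_ifs with hx
      · congr 1
        ext a
        simp [hx]
      · rw [← map_zero (LinearMap.trace k A)]
        congr 1
        ext a
        simp [Ne.symm hx]
    rw [Finset.sum_congr rfl fun x _ => this x, ← Finset.sum_filter, Finset.sum_const,
      nsmul_eq_mul, Nat.card_eq_fintype_card, Fintype.card_subtype]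
  · ext x a y
    simp [Finsupp.single_apply]

open Representation in
theorem Representation.sum_comp_eq_zero_of_mem_ker {H E : Type*} [Group H] [Fintype H]
    [AddCommGroup E] [Module k E] (ρ : Representation k H E) {x : E}
    (hx : x ∈ Coinvariants.ker ρ) : ∑ h, ρ h x = 0 := by
  have : Coinvariants.ker ρ ≤ LinearMap.ker (∑ h, ρ h) := by
    refine Submodule.span_le.2 ?_
    rintro _ ⟨⟨g, y⟩, rfl⟩
    simp only [SetLike.mem_coe, LinearMap.mem_ker, map_sub, LinearMap.sum_apply, sub_eq_zero]
    exact Fintype.sum_equiv (Equiv.mulRight g) _ _ fun h => by simp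
  simpa using this hx

open Representation in
theorem Representation.card_smul_sub_sum_mem_ker {H E : Type*} [Group H] [Fintype H]
    [AddCommGroup E] [Module k E] (ρ : Representation k H E) (x : E) :
    ∑ h, ρ h x - (Fintype.card H : k) • x ∈ Coinvariants.ker ρ := by
  have : ∑ h, ρ h x - (Fintype.card H : k) • x = ∑ h, (ρ h x - x) := by
    simp [Finset.sum_sub_distrib, Nat.cast_smul_eq_nsmul]
  rw [this]
  exact Submodule.sum_mem _ fun h _ => Coinvariants.sub_mem_ker h x

open Representation in
theorem Representation.mem_ker_iff_sum_eq_zero [CharZero k] {H E : Type*} [Group H] [Fintype H]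
    [AddCommGroup E] [Module k E] (ρ : Representation k H E) (x : E) :
    x ∈ Coinvariants.ker ρ ↔ ∑ h, ρ h x = 0 := by
  refine ⟨ρ.sum_comp_eq_zero_of_mem_ker, fun h => ?_⟩
  have := ρ.card_smul_sub_sum_mem_ker x
  rw [h, zero_sub, Submodule.neg_mem_iff] at this
  exact (Submodule.smul_mem_iff _ (Nat.cast_ne_zero.2 Fintype.card_ne_zero)).1 this

open Representation in
/-- The trace on the coinvariants (presented as a quotient `q : E → Q`) of the map induced by an
endomorphism `φ` is the average of the traces of `h ∘ φ`. -/
theorem Representation.trace_coinvariants [CharZero k] {H E Q : Type*} [Group H] [Fintype H]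
    [AddCommGroup E] [Module k E] [Module.Finite k E] [AddCommGroup Q] [Module k Q]
    (ρ : Representation k H E) (q : E →ₗ[k] Q) (hq : Function.Surjective q)
    (hker : LinearMap.ker q = Coinvariants.ker ρ) (φ : E →ₗ[k] E)
    (ψ : Q →ₗ[k] Q) (hψ : ∀ x, ψ (q x) = q (φ x)) :
    LinearMap.trace k Q ψ =
      (Fintype.card H : k)⁻¹ * ∑ h, LinearMap.trace k E (ρ h ∘ₗ φ) := by
  have : Module.Finite k Q := Module.Finite.of_surjective q hq
  have hc : (Fintype.card H : k) ≠ 0 := Nat.cast_ne_zero.2 Fintype.card_ne_zero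
  obtain ⟨σ, hσ⟩ := q.exists_rightInverse_of_surjective (LinearMap.range_eq_top.2 hq)
  replace hσ : ∀ y, q (σ y) = y := fun y => LinearMap.congr_fun hσ y
  -- the averaging operator factors through `q`
  let A : E →ₗ[k] E := (Fintype.card H : k)⁻¹ • ∑ h, ρ h
  have hA : ∀ x, A (σ (q x)) = A x := by
    intro x
    have h1 : σ (q x) - x ∈ Coinvariants.ker ρ := by
      rw [← hker, LinearMap.mem_ker, map_sub, hσ, sub_self]
    have h2 := ρ.sum_comp_eq_zero_of_mem_ker h1
    rw [← sub_eq_zero, ← map_sub]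
    simp only [A, LinearMap.smul_apply, LinearMap.sum_apply, h2, smul_zero]
  have hqA : ∀ x, q (A x) = q x := by
    intro x
    have h1 := ρ.card_smul_sub_sum_mem_ker x
    rw [← hker, LinearMap.mem_ker, map_sub, sub_eq_zero, map_smul] at h1
    simp only [A, LinearMap.smul_apply, LinearMap.sum_apply, map_smul, h1]
    rw [smul_smul, inv_mul_cancel₀ hc, one_smul]
  have h1 : ψ = (q ∘ₗ φ) ∘ₗ (A ∘ₗ σ) := by
    ext y
    have : ψ (q (A (σ y))) = q (φ (A (σ y))) := hψ _
    rw [hqA, hσ] at this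
    exact this
  have h2 : (A ∘ₗ σ) ∘ₗ (q ∘ₗ φ) = A ∘ₗ φ := by
    ext x
    exact hA (φ x)
  rw [h1, LinearMap.trace_comp_comm', h2]
  have h3 : (∑ h, ρ h) ∘ₗ φ = ∑ h, ρ h ∘ₗ φ := by
    ext x
    simp
  simp only [A, LinearMap.smul_comp, map_smul, smul_eq_mul, h3, map_sum]

end LinearAlgebra

/-! ### Coinvariants of `FI_G`-modules -/

namespace FIGModule

open FIG Representation

variable {G k : Type u} [Group G] [Field k]

theorem map_comp_apply (U : FIGModule G k) {X Y Z : FIG G} (f : X ⟶ Y) (g : Y ⟶ Z) (x : U.obj X) :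
    (U.map (f ≫ g)).hom x = (U.map g).hom ((U.map f).hom x) := by simp

theorem naturality_apply {U V : FIGModule G k} (τ : U ⟶ V) {X Y : FIG G} (f : X ⟶ Y)
    (x : U.obj X) : (τ.app Y).hom ((U.map f).hom x) = (V.map f).hom ((τ.app X).hom x) :=
  LinearMap.congr_fun (congrArg ModuleCat.Hom.hom (τ.naturality f)) x

/-- The representation of `W_n` on `U_n`. -/
noncomputable def rep (U : FIGModule G k) (n : ℕ) : Representation k (W G n) (U.obj (FIG.of n)) where
  toFun w := (U.map w.hom).hom
  map_one' := by ext x; simp [one_hom]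
  map_mul' w w' := by ext x; simp [mul_hom]

@[simp] theorem rep_apply (U : FIGModule G k) (n : ℕ) (w : W G n) :
    U.rep n w = (U.map w.hom).hom := rfl

/-- The map from the coinvariants of `U_n` to those of `U_{n+1}` is surjective. -/
def StepSurjective (U : FIGModule G k) (n : ℕ) : Prop :=
  LinearMap.range (U.map (incl n)).hom ⊔ Coinvariants.ker (U.rep (n + 1)) = ⊤

/-- The map from the coinvariants of `U_n` to those of `U_{n+1}` is injective. -/
def StepInjective (U : FIGModule G k) (n : ℕ) : Prop :=
  ∀ x : U.obj (FIG.of n), (U.map (incl n)).hom x ∈ Coinvariants.ker (U.rep (n + 1)) →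
    x ∈ Coinvariants.ker (U.rep n)

theorem map_incl_mem_ker (U : FIGModule G k) {n : ℕ} {x : U.obj (FIG.of n)}
    (hx : x ∈ Coinvariants.ker (U.rep n)) :
    (U.map (incl n)).hom x ∈ Coinvariants.ker (U.rep (n + 1)) := by
  have : Coinvariants.ker (U.rep n) ≤
      (Coinvariants.ker (U.rep (n + 1))).comap (U.map (incl n)).hom := by
    refine Submodule.span_le.2 ?_
    rintro _ ⟨⟨w, y⟩, rfl⟩
    obtain ⟨w', hw'⟩ := exists_aut_extend w
    simp only [SetLike.mem_coe, Submodule.mem_comap, map_sub, rep_apply]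
    rw [← map_comp_apply, hw', map_comp_apply]
    exact Coinvariants.sub_mem_ker (ρ := U.rep (n + 1)) w' _
  exact this hx

theorem app_mem_ker {U V : FIGModule G k} (τ : U ⟶ V) {n : ℕ} {x : U.obj (FIG.of n)}
    (hx : x ∈ Coinvariants.ker (U.rep n)) :
    (τ.app (FIG.of n)).hom x ∈ Coinvariants.ker (V.rep n) := by
  have : Coinvariants.ker (U.rep n) ≤
      (Coinvariants.ker (V.rep n)).comap (τ.app (FIG.of n)).hom := by
    refine Submodule.span_le.2 ?_
    rintro _ ⟨⟨w, y⟩, rfl⟩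
    simp only [SetLike.mem_coe, Submodule.mem_comap, map_sub, rep_apply]
    rw [naturality_apply]
    exact Coinvariants.sub_mem_ker (ρ := V.rep n) w _
  exact this hx

/-- Coinvariants are right exact: an element of `V_n` that vanishes in the coinvariants lifts to
an element of `M_n` that vanishes in the coinvariants. -/
theorem exists_mem_ker_app_eq {M V : FIGModule G k} (p : M ⟶ V)
    (hp : ∀ X, Function.Surjective (p.app X).hom) {n : ℕ} {x : V.obj (FIG.of n)}
    (hx : x ∈ Coinvariants.ker (V.rep n)) :
    ∃ y ∈ Coinvariants.ker (M.rep n), (p.app (FIG.of n)).hom y = x := by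
  have : Coinvariants.ker (V.rep n) ≤ (Coinvariants.ker (M.rep n)).map (p.app (FIG.of n)).hom := by
    refine Submodule.span_le.2 ?_
    rintro _ ⟨⟨w, y⟩, rfl⟩
    obtain ⟨z, rfl⟩ := hp _ y
    refine ⟨_, Coinvariants.sub_mem_ker (ρ := M.rep n) w z, ?_⟩
    simp only [map_sub, rep_apply, naturality_apply]
  exact this hx

theorem StepInjective.of_exact {K M V : FIGModule G k} (i : K ⟶ M) (p : M ⟶ V)
    (hex : ∀ X, Function.Exact (i.app X).hom (p.app X).hom)
    (hp : ∀ X, Function.Surjective (p.app X).hom) {n : ℕ} (hM : M.StepInjective n)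
    (hK : K.StepSurjective n) : V.StepInjective n := by
  intro x hx
  obtain ⟨y, rfl⟩ := hp _ x
  rw [← naturality_apply] at hx
  obtain ⟨z, hz, hzy⟩ := exists_mem_ker_app_eq p hp hx
  have h1 : (p.app _).hom ((M.map (incl n)).hom y - z) = 0 := by rw [map_sub, hzy, sub_self]
  obtain ⟨t, ht⟩ := (hex _ _).1 h1
  obtain ⟨_, ⟨t1, rfl⟩, t2, ht2, rfl⟩ := Submodule.mem_sup.1 (hK.symm ▸ Submodule.mem_top : t ∈ _)
  rw [map_add, naturality_apply] at ht
  have h2 : y - (i.app _).hom t1 ∈ Coinvariants.ker (M.rep n) := by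
    refine hM _ ?_
    have : (M.map (incl n)).hom (y - (i.app _).hom t1) = (i.app _).hom t2 + z := by
      rw [map_sub, sub_eq_iff_eq_add, add_right_comm, add_comm ((i.app _).hom t2), ht,
        sub_add_cancel]
    rw [this]
    exact add_mem (app_mem_ker i ht2) hz
  have h3 := app_mem_ker p h2
  rwa [map_sub, (hex _ _).2 ⟨t1, rfl⟩, sub_zero] at h3

theorem StepInjective.of_injective [Finite G] [CharZero k] {U V : FIGModule G k} (i : U ⟶ V)
    (hi : ∀ X, Function.Injective (i.app X).hom) {n : ℕ} (hV : V.StepInjective n) :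
    U.StepInjective n := by
  intro x hx
  have h1 := hV ((i.app _).hom x) (by rw [← naturality_apply]; exact app_mem_ker i hx)
  rw [mem_ker_iff_sum_eq_zero] at h1 ⊢
  refine hi _ ?_
  rw [map_zero, ← h1, map_sum]
  exact Finset.sum_congr rfl fun w _ => naturality_apply i w.hom x

/-- The average over `W_n` of the traces of `w ∘ τ` on `U_n`. -/
noncomputable def avgTrace [Finite G] (U : FIGModule G k) (τ : U ⟶ U) (n : ℕ) : k :=
  (Fintype.card (W G n) : k)⁻¹ *
    ∑ w : W G n, LinearMap.trace k (U.obj (FIG.of n)) ((U.map w.hom).hom ∘ₗ (τ.app (FIG.of n)).hom)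

/-- The average trace is the trace of `τ` on the coinvariants, hence does not change from `n` to
`n + 1` if the coinvariants do not. -/
theorem avgTrace_succ [Finite G] [CharZero k] (U : FIGModule G k) (τ : U ⟶ U) {n : ℕ}
    [Module.Finite k (U.obj (FIG.of n))] [Module.Finite k (U.obj (FIG.of (n + 1)))]
    (hs : U.StepSurjective n) (hi : U.StepInjective n) :
    U.avgTrace τ (n + 1) = U.avgTrace τ n := by
  let C (l : ℕ) := Coinvariants.ker (U.rep l)
  let T (l : ℕ) : (U.obj (FIG.of l) ⧸ C l) →ₗ[k] (U.obj (FIG.of l) ⧸ C l) :=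
    (C l).mapQ (C l) (τ.app _).hom fun x hx => app_mem_ker τ hx
  let s : (U.obj (FIG.of n) ⧸ C n) →ₗ[k] (U.obj (FIG.of (n + 1)) ⧸ C (n + 1)) :=
    (C n).mapQ (C (n + 1)) (U.map (incl n)).hom fun x hx => map_incl_mem_ker U hx
  have hs' : Function.Bijective s := by
    constructor
    · rw [injective_iff_map_eq_zero]
      intro x hx
      obtain ⟨x, rfl⟩ := Submodule.mkQ_surjective _ x
      simp only [s, Submodule.mkQ_apply, Submodule.mapQ_apply, Submodule.Quotient.mk_eq_zero] at hx ⊢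
      exact hi x hx
    · intro y
      obtain ⟨y, rfl⟩ := Submodule.mkQ_surjective _ y
      obtain ⟨_, ⟨t1, rfl⟩, t2, ht2, rfl⟩ :=
        Submodule.mem_sup.1 (hs.symm ▸ Submodule.mem_top : y ∈ _)
      refine ⟨Submodule.mkQ _ t1, ?_⟩
      simp only [s, Submodule.mkQ_apply, Submodule.mapQ_apply, Submodule.Quotient.mk_add]
      rw [(Submodule.Quotient.mk_eq_zero _).2 ht2, add_zero]
  have h (l : ℕ) [Module.Finite k (U.obj (FIG.of l))] :
      LinearMap.trace k _ (T l) = U.avgTrace τ l :=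
    trace_coinvariants (U.rep l) (C l).mkQ (Submodule.mkQ_surjective _) (Submodule.ker_mkQ _)
      (τ.app (FIG.of l)).hom (T l) fun x => rfl
  rw [← h, ← h, ← LinearMap.trace_conj' (T n) (LinearEquiv.ofBijective s hs')]
  congr 1
  refine LinearMap.ext fun x => ?_
  obtain ⟨x, rfl⟩ := (LinearEquiv.ofBijective s hs').surjective x
  obtain ⟨x, rfl⟩ := Submodule.mkQ_surjective _ x
  rw [LinearEquiv.conj_apply_apply, LinearEquiv.symm_apply_apply]
  simp only [LinearEquiv.ofBijective_apply, s, T, Submodule.mkQ_apply, Submodule.mapQ_apply]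
  rw [naturality_apply]

end FIGModule

namespace FIGModule

open FIG Representation

variable {G k : Type u} [Group G] [Field k]

/-! ### The tensor product with a free module -/

/-- The pointwise tensor product of `V` with the free module `k[Hom([a], -)]`: its value at `X`
consists of the finitely supported functions from `Hom([a], X)` to `V(X)`. -/
noncomputable def ten (V : FIGModule G k) (a : ℕ) : FIGModule G k where
  obj X := ModuleCat.of k (((FIG.of a : FIG G) ⟶ X) →₀ V.obj X)
  map {X Y} h := ModuleCat.ofHom
    (Finsupp.lmapBoth (fun f : (FIG.of a : FIG G) ⟶ X => f ≫ h) (V.map h).hom)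
  map_id X := ModuleCat.hom_ext (Finsupp.lhom_ext fun f x => by simp)
  map_comp h h' := ModuleCat.hom_ext (Finsupp.lhom_ext fun f x => by simp)

/-- The elements `f ⊗ x` of the tensor product. -/
noncomputable def tmk (V : FIGModule G k) {a : ℕ} {X : FIG G} (f : (FIG.of a : FIG G) ⟶ X) :
    V.obj X →ₗ[k] (V.ten a).obj X := Finsupp.lsingle f

/-- The coefficient in `V(X)` of `f : [a] → X`. -/
noncomputable def tcoeff (V : FIGModule G k) {a : ℕ} {X : FIG G} (f : (FIG.of a : FIG G) ⟶ X) :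
    (V.ten a).obj X →ₗ[k] V.obj X := Finsupp.lapply f

theorem ten_ext {V : FIGModule G k} {a : ℕ} {X : FIG G} {e e' : (V.ten a).obj X}
    (h : ∀ f, V.tcoeff f e = V.tcoeff f e') : e = e' := Finsupp.ext h

theorem ten_hom_ext {V : FIGModule G k} {a : ℕ} {X : FIG G} {Z : Type*} [AddCommGroup Z]
    [Module k Z] {L L' : (V.ten a).obj X →ₗ[k] Z} (h : ∀ f x, L (V.tmk f x) = L' (V.tmk f x)) :
    L = L' := Finsupp.lhom_ext h

theorem ten_exists_lift {V : FIGModule G k} {a : ℕ} {X : FIG G} {Z : Type*} [AddCommGroup Z]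
    [Module k Z] (φ : ((FIG.of a : FIG G) ⟶ X) → V.obj X →ₗ[k] Z) :
    ∃ L : (V.ten a).obj X →ₗ[k] Z, ∀ f x, L (V.tmk f x) = φ f x :=
  ⟨Finsupp.lsum k φ, fun f x => by
    change Finsupp.lsum k φ (Finsupp.single f x) = _
    simp⟩

theorem ten_exists_of_coeff [Finite G] {V : FIGModule G k} {a : ℕ} {X : FIG G}
    (x : ((FIG.of a : FIG G) ⟶ X) → V.obj X) : ∃ e : (V.ten a).obj X, ∀ f, V.tcoeff f e = x f :=
  ⟨Finsupp.equivFunOnFinite.symm x, fun _ => rfl⟩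

theorem ten_map_tmk (V : FIGModule G k) {a : ℕ} {X Y : FIG G} (h : X ⟶ Y)
    (f : (FIG.of a : FIG G) ⟶ X) (x : V.obj X) :
    ((V.ten a).map h).hom (V.tmk f x) = V.tmk (f ≫ h) ((V.map h).hom x) :=
  Finsupp.lmapBoth_single _ _ _ _

/-- The map of tensor products induced by a map of `FI_G`-modules and an endomorphism of `[a]`. -/
noncomputable def tenHom {U V : FIGModule G k} (τ : U ⟶ V) {a : ℕ}
    (u : (FIG.of a : FIG G) ⟶ FIG.of a) : U.ten a ⟶ V.ten a where
  app X := ModuleCat.ofHom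
    (Finsupp.lmapBoth (fun f : (FIG.of a : FIG G) ⟶ X => u ≫ f) (τ.app X).hom)
  naturality X Y h := ModuleCat.hom_ext <| Finsupp.lhom_ext fun f x => by
    change Finsupp.lmapBoth _ (τ.app Y).hom (Finsupp.lmapBoth _ (U.map h).hom _) =
      Finsupp.lmapBoth _ (V.map h).hom (Finsupp.lmapBoth _ (τ.app X).hom _)
    simp only [Finsupp.lmapBoth_single, naturality_apply, Category.assoc]

theorem tenHom_app_tmk {U V : FIGModule G k} (τ : U ⟶ V) {a : ℕ}
    (u : (FIG.of a : FIG G) ⟶ FIG.of a) {X : FIG G} (f : (FIG.of a : FIG G) ⟶ X) (x : U.obj X) :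
    ((tenHom τ u).app X).hom (U.tmk f x) = V.tmk (u ≫ f) ((τ.app X).hom x) :=
  Finsupp.lmapBoth_single _ _ _ _

theorem tcoeff_tenHom_id {U V : FIGModule G k} (τ : U ⟶ V) {a : ℕ} {X : FIG G}
    (e : (U.ten a).obj X) (f : (FIG.of a : FIG G) ⟶ X) :
    V.tcoeff f (((tenHom τ (𝟙 (FIG.of a))).app X).hom e) = (τ.app X).hom (U.tcoeff f e) := by
  have : (fun f : (FIG.of a : FIG G) ⟶ X => 𝟙 _ ≫ f) = id := funext fun f => Category.id_comp f
  change Finsupp.lmapBoth (fun f : (FIG.of a : FIG G) ⟶ X => 𝟙 _ ≫ f) (τ.app X).hom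
    (show (FIG.of a ⟶ X) →₀ U.obj X from e) f = _
  rw [this, Finsupp.lmapBoth, LinearMap.comp_apply, Finsupp.lmapDomain_apply, Finsupp.mapDomain_id]
  rfl

theorem tenHom_injective {U V : FIGModule G k} (τ : U ⟶ V) (a : ℕ)
    (h : ∀ X, Function.Injective (τ.app X).hom) (X : FIG G) :
    Function.Injective ((tenHom τ (𝟙 (FIG.of a))).app X).hom := fun e e' he =>
  ten_ext fun f => h X (by rw [← tcoeff_tenHom_id, ← tcoeff_tenHom_id, he])

theorem tenHom_surjective [Finite G] {U V : FIGModule G k} (τ : U ⟶ V) (a : ℕ)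
    (h : ∀ X, Function.Surjective (τ.app X).hom) (X : FIG G) :
    Function.Surjective ((tenHom τ (𝟙 (FIG.of a))).app X).hom := by
  intro e
  choose x hx using fun f => h X (V.tcoeff f e)
  obtain ⟨y, hy⟩ := ten_exists_of_coeff x
  exact ⟨y, ten_ext fun f => by rw [tcoeff_tenHom_id, hy, hx]⟩

theorem tenHom_exact [Finite G] {K M V : FIGModule G k} (i : K ⟶ M) (p : M ⟶ V) (a : ℕ)
    (h : ∀ X, Function.Exact (i.app X).hom (p.app X).hom) (X : FIG G) :
    Function.Exact ((tenHom i (𝟙 (FIG.of a))).app X).hom ((tenHom p (𝟙 (FIG.of a))).app X).hom := by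
  intro e
  constructor
  · intro he
    have h1 : ∀ f, ∃ x, (i.app X).hom x = M.tcoeff f e := fun f =>
      (h X _).1 (by rw [← tcoeff_tenHom_id, he, map_zero])
    choose x hx using h1
    obtain ⟨y, hy⟩ := ten_exists_of_coeff x
    exact ⟨y, ten_ext fun f => by rw [tcoeff_tenHom_id, hy, hx]⟩
  · rintro ⟨x, rfl⟩
    refine ten_ext fun f => ?_
    rw [tcoeff_tenHom_id, tcoeff_tenHom_id, map_zero]
    exact (h X _).2 ⟨_, rfl⟩

instance [Finite G] (V : FIGModule G k) (a : ℕ) (X : FIG G) [Module.Finite k (V.obj X)] :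
    Module.Finite k ((V.ten a).obj X) :=
  inferInstanceAs (Module.Finite k (((FIG.of a : FIG G) ⟶ X) →₀ V.obj X))

theorem stepSurjective_ten {V : FIGModule G k} {N : ℕ} (hV : V.IsGeneratedInDegree N) {a n : ℕ}
    (h : N + a ≤ n) : (V.ten a).StepSurjective n := by
  rw [StepSurjective, eq_top_iff]
  intro e _
  set S := LinearMap.range ((V.ten a).map (incl n)).hom ⊔ Coinvariants.ker ((V.ten a).rep (n + 1))
    with hS
  suffices h1 : ∀ (f' : (FIG.of a : FIG G) ⟶ FIG.of (n + 1)), V.generated {p | p.1 ≤ N} (n + 1) ≤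
      S.comap (V.tmk f') by
    have h2 : S.mkQ = 0 := ten_hom_ext fun f' x =>
      (Submodule.Quotient.mk_eq_zero _).2 (h1 f' ((hV (n + 1)).symm ▸ Submodule.mem_top : x ∈ _))
    exact (Submodule.Quotient.mk_eq_zero _).1 (LinearMap.congr_fun h2 e)
  intro f'
  refine Submodule.span_le.2 ?_
  rintro _ ⟨j, x, f, hj, rfl⟩
  obtain ⟨w, g, g', hg, hg'⟩ := exists_factor_pair (show j + a ≤ n from
    (Nat.add_le_add_right hj a).trans h) f f'
  have h2 := Coinvariants.sub_mem_ker (ρ := (V.ten a).rep (n + 1)) w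
    (V.tmk f' ((V.map f).hom x))
  have h3 : (V.ten a).rep (n + 1) w (V.tmk f' ((V.map f).hom x)) =
      ((V.ten a).map (incl n)).hom (V.tmk g' ((V.map g).hom x)) := by
    rw [rep_apply, ten_map_tmk, ten_map_tmk, ← map_comp_apply, ← map_comp_apply, hg, hg']
  rw [h3] at h2
  have h4 := sub_mem (Submodule.mem_sup_left (LinearMap.mem_range_self
    ((V.ten a).map (incl n)).hom (V.tmk g' ((V.map g).hom x))) : _ ∈ S)
    (Submodule.mem_sup_right h2 : _ ∈ S)
  rwa [sub_sub_cancel] at h4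

/-! ### Relatively projective modules -/

/-- The symbols `f ⊗ x` in an induced module. -/
noncomputable def imk {d : ℕ} (A : Rep.{u} k (FIG.W G d)) {X : FIG G} (f : (FIG.of d : FIG G) ⟶ X) :
    A →ₗ[k] (ind A).obj X := (indRel A X).mkQ ∘ₗ Finsupp.lsingle f

section ind

variable {d : ℕ} (A : Rep.{u} k (FIG.W G d))

theorem ind_map_imk {X Y : FIG G} (h : X ⟶ Y) (f : (FIG.of d : FIG G) ⟶ X) (x : A) :
    ((ind A).map h).hom (imk A f x) = imk A (f ≫ h) x := by
  change Submodule.Quotient.mk (Finsupp.mapDomain _ _) = Submodule.Quotient.mk _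
  rw [Finsupp.lsingle_apply, Finsupp.mapDomain_single]
  rfl

theorem imk_comp {X : FIG G} (w : W G d) (f : (FIG.of d : FIG G) ⟶ X) (x : A) :
    imk A (w.hom ≫ f) x = imk A f (A.ρ w x) :=
  (Submodule.Quotient.eq _).2 (Submodule.subset_span ⟨w, f, x, rfl⟩)

variable {A}

theorem ind_hom_ext {X : FIG G} {Z : Type*} [AddCommGroup Z] [Module k Z]
    {L L' : (ind A).obj X →ₗ[k] Z} (h : ∀ f x, L (imk A f x) = L' (imk A f x)) : L = L' :=
  Submodule.linearMap_qext _ (Finsupp.lhom_ext h)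

theorem ind_exists_lift {X : FIG G} {Z : Type*} [AddCommGroup Z] [Module k Z]
    (φ : ((FIG.of d : FIG G) ⟶ X) → A →ₗ[k] Z)
    (hφ : ∀ f (w : W G d) x, φ (w.hom ≫ f) x = φ f (A.ρ w x)) :
    ∃ L : (ind A).obj X →ₗ[k] Z, ∀ f x, L (imk A f x) = φ f x := by
  have h : ∀ f x, Finsupp.lsum k φ (Finsupp.single f x) = φ f x := fun f x => by simp
  refine ⟨(indRel A X).liftQ (Finsupp.lsum k φ) (Submodule.span_le.2 ?_), h⟩
  rintro _ ⟨w, f, x, rfl⟩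
  rw [SetLike.mem_coe, LinearMap.mem_ker, map_sub, h, h, hφ, sub_self]

end ind

theorem hom_ext_of_bijective_toModule {ι : Type*} [DecidableEq ι] {N : ι → Type*} {M : Type*}
    [∀ a, AddCommGroup (N a)] [∀ a, Module k (N a)] [AddCommGroup M] [Module k M]
    {j : ∀ a, N a →ₗ[k] M} (hj : Function.Bijective (DirectSum.toModule k ι M j))
    {Z : Type*} [AddCommGroup Z] [Module k Z] {L L' : M →ₗ[k] Z}
    (h : ∀ a x, L (j a x) = L' (j a x)) : L = L' := by
  have h1 : L ∘ₗ DirectSum.toModule k ι M j = L' ∘ₗ DirectSum.toModule k ι M j :=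
    DirectSum.linearMap_ext _ fun a => LinearMap.ext fun x => by
      simpa [DirectSum.toModule_lof] using h a x
  ext y
  obtain ⟨y, rfl⟩ := hj.2 y
  exact LinearMap.congr_fun h1 y

theorem exists_lift_of_bijective_toModule {ι : Type*} [DecidableEq ι] {N : ι → Type*} {M : Type*}
    [∀ a, AddCommGroup (N a)] [∀ a, Module k (N a)] [AddCommGroup M] [Module k M]
    {j : ∀ a, N a →ₗ[k] M} (hj : Function.Bijective (DirectSum.toModule k ι M j))
    {Z : Type*} [AddCommGroup Z] [Module k Z] (φ : ∀ a, N a →ₗ[k] Z) :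
    ∃ L : M →ₗ[k] Z, ∀ a x, L (j a x) = φ a x := by
  let e := LinearEquiv.ofBijective _ hj
  refine ⟨DirectSum.toModule k ι Z φ ∘ₗ e.symm.toLinearMap, fun a x => ?_⟩
  have h1 : j a x = e (DirectSum.lof k ι N a x) := by simp [e, DirectSum.toModule_lof]
  rw [h1]
  simp [DirectSum.toModule_lof]

/-- The value of an induced module is spanned by symbols `f ⊗ x`, and so is that of a direct sum
of induced modules. Linear maps out of it are given by their values on the symbols, subject to
`(w ≫ f) ⊗ x = f ⊗ w x`. -/
theorem IsRelativelyProjective.exists_symbols {M : FIGModule G k} (hM : M.IsRelativelyProjective) :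
    ∃ (ι : Type u) (d : ι → ℕ) (A : ∀ a, Rep.{u} k (FIG.W G (d a)))
      (sym : ∀ a (X : FIG G), (FIG.of (d a) ⟶ X) → A a →ₗ[k] M.obj X),
      (∀ a (X Y : FIG G) (f : FIG.of (d a) ⟶ X) (h : X ⟶ Y) x,
        (M.map h).hom (sym a X f x) = sym a Y (f ≫ h) x) ∧
      (∀ a (X : FIG G) (f : FIG.of (d a) ⟶ X) (w : W G (d a)) x,
        sym a X (w.hom ≫ f) x = sym a X f ((A a).ρ w x)) ∧
      (∀ (X : FIG G) (Z : Type u) [AddCommGroup Z] [Module k Z] (L L' : M.obj X →ₗ[k] Z),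
        (∀ a f x, L (sym a X f x) = L' (sym a X f x)) → L = L') ∧
      (∀ (X : FIG G) (Z : Type u) [AddCommGroup Z] [Module k Z]
        (φ : ∀ a, (FIG.of (d a) ⟶ X) → A a →ₗ[k] Z),
        (∀ a f (w : W G (d a)) x, φ a (w.hom ≫ f) x = φ a f ((A a).ρ w x)) →
          ∃ L : M.obj X →ₗ[k] Z, ∀ a f x, L (sym a X f x) = φ a f x) := by
  classical
  obtain ⟨ι, d, A, j, hj⟩ := hM
  refine ⟨ι, d, A, fun a X f => ((j a).app X).hom ∘ₗ imk (A a) f, ?_, ?_, ?_, ?_⟩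
  · intro a X Y f h x
    rw [LinearMap.comp_apply, ← naturality_apply, ind_map_imk]
    rfl
  · intro a X f w x
    rw [LinearMap.comp_apply, imk_comp]
    rfl
  · intro X Z _ _ L L' h
    exact hom_ext_of_bijective_toModule (hj X) fun a x => LinearMap.congr_fun
      (ind_hom_ext (L := L ∘ₗ ((j a).app X).hom) (L' := L' ∘ₗ ((j a).app X).hom) (h a)) x
  · intro X Z _ _ φ hφ
    choose ψ hψ using fun a => ind_exists_lift (φ a) (hφ a)
    obtain ⟨L, hL⟩ := exists_lift_of_bijective_toModule (hj X) ψ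
    exact ⟨L, fun a f x => (hL a _).trans (hψ a f x)⟩

/-- On the coinvariants of `M ⊗ k[Hom([a], -)]`, the step from `n` to `n + 1` has a left inverse:
pairs of morphisms to `[n + 1]` that can be moved into `[n]` are, and the others are discarded. -/
theorem IsRelativelyProjective.stepInjective_ten {M : FIGModule G k}
    (hM : M.IsRelativelyProjective) (a n : ℕ) : (M.ten a).StepInjective n := by
  classical
  obtain ⟨ι, d, A, sym, hnat, hcompat, hext, hlift⟩ := hM.exists_symbols
  let mk := (Coinvariants.ker ((M.ten a).rep n)).mkQ
  let P (f' : (FIG.of a : FIG G) ⟶ FIG.of (n + 1)) (i : ι) (f : FIG.of (d i) ⟶ FIG.of (n + 1))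
      (t : (FIG.of a ⟶ FIG.of n) × (FIG.of (d i) ⟶ (FIG.of n : FIG G))) : Prop :=
    ∃ w : W G (n + 1), f' ≫ w.hom = t.1 ≫ incl n ∧ f ≫ w.hom = t.2 ≫ incl n
  let Ψ (i : ι) (t : (FIG.of a ⟶ FIG.of n) × (FIG.of (d i) ⟶ (FIG.of n : FIG G))) :
      A i →ₗ[k] ((M.ten a).obj (FIG.of n) ⧸ Coinvariants.ker ((M.ten a).rep n)) :=
    mk ∘ₗ M.tmk t.1 ∘ₗ sym i _ t.2
  let Φ (f' : (FIG.of a : FIG G) ⟶ FIG.of (n + 1)) (i : ι) (f : FIG.of (d i) ⟶ FIG.of (n + 1)) :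
      A i →ₗ[k] ((M.ten a).obj (FIG.of n) ⧸ Coinvariants.ker ((M.ten a).rep n)) :=
    if h : ∃ t, P f' i f t then Ψ i h.choose else 0
  -- the value does not depend on the choice of `t`, because pairs of morphisms to `[n]` that are
  -- conjugate under `W_{n+1}` are conjugate under `W_n`
  have hΨ : ∀ f' i f t t', P f' i f t → P f' i f t' → Ψ i t = Ψ i t' := by
    rintro f' i f ⟨g', g⟩ ⟨h', h⟩ ⟨w, hw1, hw2⟩ ⟨v, hv1, hv2⟩
    obtain ⟨z, hz⟩ := exists_aut_restrict (v * w⁻¹)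
    have e1 : g' ≫ z.hom = h' := hz _ _ _ (by
      rw [← hw1, ← hv1]
      simp [mul_hom, inv_hom])
    have e2 : g ≫ z.hom = h := hz _ _ _ (by
      rw [← hw2, ← hv2]
      simp [mul_hom, inv_hom])
    ext x
    refine ((Submodule.Quotient.eq _).2 ?_).symm
    have := Coinvariants.sub_mem_ker (ρ := (M.ten a).rep n) z (M.tmk g' (sym i _ g x))
    rwa [rep_apply, ten_map_tmk, hnat, e1, e2] at this
  have hΦ : ∀ f' i f t, P f' i f t → Φ f' i f = Ψ i t := by
    intro f' i f t ht
    have h : ∃ t, P f' i f t := ⟨t, ht⟩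
    simp only [Φ, dif_pos h]
    exact hΨ _ _ _ _ _ h.choose_spec ht
  have hcompat' : ∀ f' i f (w : W G (d i)) x, Φ f' i (w.hom ≫ f) x = Φ f' i f ((A i).ρ w x) := by
    intro f' i f w x
    by_cases h : ∃ t, P f' i f t
    · obtain ⟨t, ht⟩ := h
      have ht' : P f' i (w.hom ≫ f) (t.1, w.hom ≫ t.2) := by
        obtain ⟨v, hv1, hv2⟩ := ht
        exact ⟨v, hv1, by simp [hv2]⟩
      rw [hΦ _ _ _ _ ht, hΦ _ _ _ _ ht']
      simp only [Ψ, LinearMap.comp_apply, hcompat]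
    · have h' : ¬ ∃ t, P f' i (w.hom ≫ f) t := by
        rintro ⟨t, v, hv1, hv2⟩
        refine h ⟨(t.1, w.inv ≫ t.2), v, hv1, ?_⟩
        rw [Category.assoc, ← hv2]
        simp
      simp only [Φ, dif_neg h, dif_neg h', LinearMap.zero_apply]
  choose L hL using fun f' => hlift (FIG.of (n + 1)) _ (Φ f') (hcompat' f')
  obtain ⟨S, hS⟩ := ten_exists_lift (V := M) L
  have hSker : Coinvariants.ker ((M.ten a).rep (n + 1)) ≤ LinearMap.ker S := by
    refine Submodule.span_le.2 ?_
    rintro _ ⟨⟨v, y⟩, rfl⟩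
    simp only [SetLike.mem_coe, LinearMap.mem_ker, map_sub, sub_eq_zero]
    suffices h : S ∘ₗ (M.ten a).rep (n + 1) v = S from LinearMap.congr_fun h y
    refine ten_hom_ext fun f' y => LinearMap.congr_fun (hext _ _ ((S ∘ₗ (M.ten a).rep (n + 1) v) ∘ₗ
      M.tmk f') (S ∘ₗ M.tmk f') fun i f x => ?_) y
    change S ((M.ten a).rep (n + 1) v (M.tmk f' _)) = S (M.tmk f' _)
    rw [rep_apply, ten_map_tmk, hnat, hS, hS, hL, hL]
    congr 1
    by_cases h : ∃ t, P f' i f t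
    · obtain ⟨t, ht⟩ := h
      rw [hΦ _ _ _ _ ht, hΦ _ _ _ t]
      obtain ⟨w, hw1, hw2⟩ := ht
      exact ⟨w * v⁻¹, by simp [mul_hom, inv_hom, hw1], by simp [mul_hom, inv_hom, hw2]⟩
    · have h' : ¬ ∃ t, P (f' ≫ v.hom) i (f ≫ v.hom) t := by
        rintro ⟨t, w, hw1, hw2⟩
        exact h ⟨t, w * v, by simp [mul_hom, ← hw1], by simp [mul_hom, ← hw2]⟩
      simp only [Φ, dif_neg h, dif_neg h']
  have hSstep : S ∘ₗ ((M.ten a).map (incl n)).hom = mk := by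
    refine ten_hom_ext fun g' y => LinearMap.congr_fun (hext _ _ ((S ∘ₗ ((M.ten a).map (incl n)).hom)
      ∘ₗ M.tmk g') (mk ∘ₗ M.tmk g') fun i g x => ?_) y
    change S (((M.ten a).map (incl n)).hom (M.tmk g' _)) = mk (M.tmk g' _)
    rw [ten_map_tmk, hnat, hS, hL, hΦ _ _ _ (g', g) ⟨1, by simp [one_hom], by simp [one_hom]⟩]
    rfl
  intro x hx
  rw [← Submodule.Quotient.mk_eq_zero, ← Submodule.mkQ_apply]
  change mk x = 0
  rw [← hSstep]
  exact hSker hx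

end FIGModule

namespace FIG

variable {G : Type u} [Group G]

/-! ### Equivariant morphisms -/

/-- The number of morphisms `f : [a] → [n]` that intertwine `u ∈ W_a` and `w ∈ W_n`. As functions
of `w`, these numbers are the building blocks of all characters below. -/
noncomputable def eqCount {a n : ℕ} (u : W G a) (w : W G n) : ℕ :=
  Nat.card {f : (FIG.of a : FIG G) ⟶ FIG.of n // u.hom ≫ f = f ≫ w.hom}

theorem inv_comp_comp_eq_iff {a n : ℕ} (u : W G a) (w : W G n) (f : (FIG.of a : FIG G) ⟶ FIG.of n) :
    (u.inv ≫ f) ≫ w.hom = f ↔ u.hom ≫ f = f ≫ w.hom := by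
  constructor
  · intro h
    conv_lhs => rw [← h]
    simp
  · intro h
    rw [Category.assoc, ← h, aut_inv_hom_assoc]

theorem card_inv_comp_comp_eq {a n : ℕ} (u : W G a) (w : W G n) :
    Nat.card {f : (FIG.of a : FIG G) ⟶ FIG.of n // (u.inv ≫ f) ≫ w.hom = f} = eqCount u w :=
  Nat.card_congr (Equiv.subtypeEquivRight fun f => inv_comp_comp_eq_iff u w f)

end FIG

namespace FIGModule

open FIG Representation

variable {G k : Type u} [Group G] [Field k]

theorem trace_ten_map [Finite G] (V : FIGModule G k) (τ : V ⟶ V) {a n : ℕ} (u : W G a) (w : W G n)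
    [Module.Finite k (V.obj (FIG.of n))] :
    LinearMap.trace k ((V.ten a).obj (FIG.of n))
      (((V.ten a).map w.hom).hom ∘ₗ ((tenHom τ u.inv).app (FIG.of n)).hom) =
    eqCount u w * LinearMap.trace k (V.obj (FIG.of n))
      ((V.map w.hom).hom ∘ₗ (τ.app (FIG.of n)).hom) := by
  have : ((V.ten a).map w.hom).hom ∘ₗ ((tenHom τ u.inv).app (FIG.of n)).hom =
      Finsupp.lmapBoth (fun f : (FIG.of a : FIG G) ⟶ FIG.of n => (u.inv ≫ f) ≫ w.hom)
        ((V.map w.hom).hom ∘ₗ (τ.app (FIG.of n)).hom) := by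
    refine ten_hom_ext fun f x => ?_
    rw [LinearMap.comp_apply, tenHom_app_tmk, ten_map_tmk]
    exact (Finsupp.lmapBoth_single (fun f : (FIG.of a : FIG G) ⟶ FIG.of n => (u.inv ≫ f) ≫ w.hom)
      ((V.map w.hom).hom ∘ₗ (τ.app (FIG.of n)).hom) f x).symm
  rw [← card_inv_comp_comp_eq, this]
  exact Finsupp.trace_lmapBoth (fun f : (FIG.of a : FIG G) ⟶ FIG.of n => (u.inv ≫ f) ≫ w.hom)
    ((V.map w.hom).hom ∘ₗ (τ.app (FIG.of n)).hom)

/-- The scalar product of a (twisted) character with the function `eqCount u` does not change from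
`n` to `n + 1` where the coinvariants of `V ⊗ k[Hom([a], -)]` are stable. -/
theorem sum_eqCount_mul_trace_succ [Finite G] [CharZero k] (V : FIGModule G k) (τ : V ⟶ V) {a n : ℕ}
    (u : W G a) [∀ X, Module.Finite k (V.obj X)]
    (hs : (V.ten a).StepSurjective n) (hi : (V.ten a).StepInjective n) :
    (Fintype.card (W G (n + 1)) : k)⁻¹ * ∑ w : W G (n + 1), eqCount u w *
      LinearMap.trace k (V.obj (FIG.of (n + 1)))
        ((V.map w.hom).hom ∘ₗ (τ.app (FIG.of (n + 1))).hom) =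
    (Fintype.card (W G n) : k)⁻¹ * ∑ w : W G n, eqCount u w *
      LinearMap.trace k (V.obj (FIG.of n)) ((V.map w.hom).hom ∘ₗ (τ.app (FIG.of n)).hom) := by
  have := avgTrace_succ (V.ten a) (tenHom τ u.inv) hs hi
  simpa only [avgTrace, trace_ten_map] using this

/-! ### The free modules -/

/-- The constant `FI_G`-module `k`. -/
noncomputable abbrev unit (G k : Type u) [Group G] [Field k] : FIGModule G k :=
  (Functor.const _).obj (ModuleCat.of k k)

/-- The free `FI_G`-module `k[Hom([b], -)]`. -/
noncomputable abbrev free (G k : Type u) [Group G] [Field k] (b : ℕ) : FIGModule G k :=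
  (unit G k).ten b

theorem free_isGeneratedInDegree (b : ℕ) : (free G k b).IsGeneratedInDegree b := by
  intro n
  rw [eq_top_iff]
  intro e _
  have h2 : ((free G k b).generated {p | p.1 ≤ b} n).mkQ = 0 := ten_hom_ext fun f x =>
    (Submodule.Quotient.mk_eq_zero _).2 <| Submodule.subset_span
      ⟨b, (unit G k).tmk (𝟙 _) x, f, le_refl b, by
        rw [ten_map_tmk, Category.id_comp]
        rfl⟩
  exact (Submodule.Quotient.mk_eq_zero _).1 (LinearMap.congr_fun h2 e)

/-- The regular representation of a group. -/
noncomputable def regular (k H : Type u) [Field k] [Group H] : Representation k H (H →₀ k) where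
  toFun h := Finsupp.lmapDomain k k (h * ·)
  map_one' := by ext; simp
  map_mul' h h' := by ext; simp [mul_assoc, Finsupp.mapDomain_single]

theorem regular_single {k H : Type u} [Field k] [Group H] (h h' : H) (c : k) :
    regular k H h (Finsupp.single h' c) = Finsupp.single (h * h') c := by
  simp [regular, Finsupp.mapDomain_single]

theorem bijective_toModule_of_unique {ι N M : Type*} {_ : DecidableEq ι} [Unique ι] [AddCommGroup N]
    [Module k N] [AddCommGroup M] [Module k M] (L : N →ₗ[k] M) (hL : Function.Bijective L) :
    Function.Bijective (DirectSum.toModule k ι M fun _ : ι => L) := by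
  let e := LinearEquiv.ofBijective L hL
  have he : ∀ y, L (e.symm y) = y := e.apply_symm_apply
  have he' : ∀ x, e.symm (L x) = x := e.symm_apply_apply
  refine Function.bijective_iff_has_inverse.2
    ⟨fun y => DirectSum.lof k ι (fun _ => N) default (e.symm y), fun z => ?_, fun y => ?_⟩
  · have : (DirectSum.lof k ι (fun _ => N) default ∘ₗ e.symm.toLinearMap) ∘ₗ
        DirectSum.toModule k ι M (fun _ => L) = LinearMap.id := by
      refine DirectSum.linearMap_ext _ fun i => LinearMap.ext fun x => ?_
      obtain rfl := Unique.eq_default i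
      simp only [LinearMap.comp_apply, DirectSum.toModule_lof, LinearEquiv.coe_coe, he',
        LinearMap.id_apply]
    exact LinearMap.congr_fun this z
  · simp only [DirectSum.toModule_lof, he]

/-- The free module `k[Hom([b], -)]` is induced from the regular representation of `W_b`. -/
theorem free_isRelativelyProjective (b : ℕ) : (free G k b).IsRelativelyProjective := by
  classical
  let A : Rep.{u} k (W G b) := Rep.of (regular k (W G b))
  have h1 : ∀ X : FIG G, ∃ L : (ind A).obj X →ₗ[k] (free G k b).obj X, ∀ f (w : W G b) (c : k),
      L (imk A f (Finsupp.single w c)) = (unit G k).tmk (w.hom ≫ f) c := by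
    intro X
    obtain ⟨L, hL⟩ := ind_exists_lift (A := A) (fun f : (FIG.of b : FIG G) ⟶ X =>
      (Finsupp.lsum k fun w : W G b => (unit G k).tmk (w.hom ≫ f) : (W G b →₀ k) →ₗ[k] _)) <| by
        intro f w x
        induction x using Finsupp.induction_linear with
        | zero => simp only [map_zero]
        | add x y hx hy => simp only [map_add, hx, hy]
        | single v c =>
          change Finsupp.lsum k _ _ = Finsupp.lsum k _ (regular k (W G b) w _)
          rw [regular_single, Finsupp.lsum_single, Finsupp.lsum_single, mul_hom, Category.assoc]
    refine ⟨L, fun f w c => ?_⟩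
    rw [hL]
    exact Finsupp.lsum_single ..
  choose L hL using h1
  have hA : ∀ {X : FIG G} {Z : Type u} [AddCommGroup Z] [Module k Z] {T T' : (ind A).obj X →ₗ[k] Z},
      (∀ f (w : W G b) (c : k), T (imk A f (Finsupp.single w c)) =
        T' (imk A f (Finsupp.single w c))) → T = T' := by
    intro X Z _ _ T T' h
    refine ind_hom_ext fun f x => ?_
    exact LinearMap.congr_fun (Finsupp.lhom_ext (φ := T ∘ₗ imk A f) (ψ := T' ∘ₗ imk A f) (h f)) x
  choose R hR using fun X : FIG G => ten_exists_lift (V := unit G k) (a := b) (X := X)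
    fun f => imk A f ∘ₗ Finsupp.lsingle 1
  have hLR : ∀ X y, L X (R X y) = y := fun X y =>
    LinearMap.congr_fun (ten_hom_ext (V := unit G k) (L := L X ∘ₗ R X) (L' := LinearMap.id)
      fun f x => by
        change L X (R X _) = _
        rw [hR]
        refine (hL X f 1 x).trans ?_
        rw [one_hom, Category.id_comp]
        rfl) y
  have hRL : ∀ X y, R X (L X y) = y := fun X y =>
    LinearMap.congr_fun (hA (T := R X ∘ₗ L X) (T' := LinearMap.id) fun f w c => by
        change R X (L X _) = _
        rw [hL, hR]
        change imk A _ (Finsupp.single 1 c) = imk A _ (Finsupp.single w c)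
        rw [imk_comp]
        change imk A f (regular k (W G b) w _) = _
        rw [regular_single, mul_one]) y
  refine ⟨PUnit, fun _ => b, fun _ => A, fun _ =>
    { app X := ModuleCat.ofHom (L X), naturality X Y h := ?_ }, fun X => ?_⟩
  · refine ModuleCat.hom_ext (hA fun f w c => ?_)
    change L Y (((ind A).map h).hom _) = ((free G k b).map h).hom (L X _)
    rw [ind_map_imk, hL, hL, ten_map_tmk, Category.assoc]
    rfl
  · exact bijective_toModule_of_unique (L X)
      (Function.bijective_iff_has_inverse.2 ⟨R X, hRL X, hLR X⟩)

/-- The Gram matrix of the functions `eqCount u` on `W_n` is independent of `n`, for `n` large. -/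
theorem sum_eqCount_mul_eqCount_succ [Finite G] [CharZero k] {a b n : ℕ} (h : a + b ≤ n)
    (u : W G a) (v : W G b) :
    (Fintype.card (W G (n + 1)) : k)⁻¹ * ∑ w : W G (n + 1), (eqCount u w : k) * eqCount v w =
    (Fintype.card (W G n) : k)⁻¹ * ∑ w : W G n, (eqCount u w : k) * eqCount v w := by
  have hfin : ∀ X, Module.Finite k ((free G k b).obj X) := fun X =>
    inferInstanceAs (Module.Finite k (((FIG.of b : FIG G) ⟶ X) →₀ k))
  have h1 := sum_eqCount_mul_trace_succ (free G k b) (tenHom (𝟙 _) v.inv) u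
    (stepSurjective_ten (free_isGeneratedInDegree b) (by omega : b + a ≤ n))
    ((free_isRelativelyProjective b).stepInjective_ten a n)
  have h2 : ∀ (l : ℕ) (w : W G l), LinearMap.trace k ((free G k b).obj (FIG.of l))
      (((free G k b).map w.hom).hom ∘ₗ ((tenHom (𝟙 (unit G k)) v.inv).app (FIG.of l)).hom) =
        eqCount v w := by
    intro l w
    have : Module.Finite k ((unit G k).obj (FIG.of l)) := inferInstanceAs (Module.Finite k k)
    rw [trace_ten_map]
    have : ((unit G k).map w.hom).hom ∘ₗ ((𝟙 (unit G k) : unit G k ⟶ unit G k).app (FIG.of l)).hom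
      = LinearMap.id := rfl
    rw [this, LinearMap.trace_id]
    have h3 : Module.finrank k ((unit G k).obj (FIG.of l)) = 1 := Module.finrank_self k
    rw [h3, Nat.cast_one, mul_one]
  simpa only [h2] using h1

/-! ### The characters of induced modules -/

/-- The value `ind A` at `[n]` consists of the coinvariants of `W_d` on `k[Hom([d], [n])] ⊗ A`, on
which the trace is an average. -/
theorem trace_ind_map [Finite G] [CharZero k] {d n : ℕ} (A : Rep.{u} k (W G d))
    [Module.Finite k A] (w : W G n) :
    LinearMap.trace k ((ind A).obj (FIG.of n)) ((ind A).map w.hom).hom =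
      (Fintype.card (W G d) : k)⁻¹ * ∑ u : W G d, eqCount u w * LinearMap.trace k A (A.ρ u) := by
  let ρ : Representation k (W G d) (((FIG.of d : FIG G) ⟶ FIG.of n) →₀ A) :=
    { toFun u := Finsupp.lmapBoth (fun f => u.inv ≫ f) (A.ρ u)
      map_one' := by
        refine Finsupp.lhom_ext fun f x => ?_
        have : (1 : W G d).inv ≫ f = f := Category.id_comp f
        simp [this]
      map_mul' u v := by
        refine Finsupp.lhom_ext fun f x => ?_
        have : (u * v).inv ≫ f = u.inv ≫ v.inv ≫ f := Category.assoc _ _ _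
        simp [this] }
  have hρ : ∀ u f x, ρ u (Finsupp.single f x) = Finsupp.single (u.inv ≫ f) (A.ρ u x) :=
    fun u f x => Finsupp.lmapBoth_single _ _ _ _
  have hker : LinearMap.ker (indRel A (FIG.of n)).mkQ = Coinvariants.ker ρ := by
    rw [Submodule.ker_mkQ]
    refine le_antisymm (Submodule.span_le.2 ?_) (Submodule.span_le.2 ?_)
    · rintro _ ⟨u, f, x, rfl⟩
      have := Coinvariants.sub_mem_ker (ρ := ρ) u (Finsupp.single (u.hom ≫ f) x)
      rw [hρ, aut_inv_hom_assoc] at this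
      rw [SetLike.mem_coe, ← Submodule.neg_mem_iff, neg_sub]
      exact this
    · rintro _ ⟨⟨u, e⟩, rfl⟩
      dsimp only
      induction e using Finsupp.induction_linear with
      | zero => simp
      | add x y hx hy =>
        rw [map_add, add_sub_add_comm]
        exact add_mem hx hy
      | single f x =>
        rw [hρ, SetLike.mem_coe, ← Submodule.neg_mem_iff, neg_sub]
        refine Submodule.subset_span ⟨u, u.inv ≫ f, x, ?_⟩
        rw [aut_hom_inv_assoc]
  have h1 := trace_coinvariants ρ (indRel A (FIG.of n)).mkQ (Submodule.mkQ_surjective _) hker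
    (Finsupp.lmapBoth (fun f => f ≫ w.hom) LinearMap.id) ((ind A).map w.hom).hom (fun e => by
      change Submodule.Quotient.mk _ = Submodule.Quotient.mk _
      congr 1
      exact LinearMap.congr_fun (Finsupp.lhom_ext (φ := Finsupp.lmapDomain A k
        (fun f : (FIG.of d : FIG G) ⟶ FIG.of n => f ≫ w.hom)) fun f x => by
          simp [Finsupp.mapDomain_single]) e)
  refine h1.trans ?_
  congr 1
  refine Finset.sum_congr rfl fun u _ => ?_
  rw [← card_inv_comp_comp_eq, ← Finsupp.trace_lmapBoth]
  congr 1
  refine Finsupp.lhom_ext fun f x => ?_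
  rw [LinearMap.comp_apply, Finsupp.lmapBoth_single, Finsupp.lmapBoth_single, hρ, Category.assoc]
  rfl

end FIGModule

namespace FIG

variable {G : Type u} [Group G]

/-! ### Counting partially equivariant morphisms -/

/-- The number of `h : [N] → [n]` for which `w ∈ W_n` carries `f₀ ≫ h` to `f₁ ≫ h`. -/
noncomputable def pairCount {d N n : ℕ} (f₀ f₁ : (FIG.of d : FIG G) ⟶ FIG.of N) (w : W G n) : ℕ :=
  Nat.card {h : (FIG.of N : FIG G) ⟶ FIG.of n // f₀ ≫ h ≫ w.hom = f₁ ≫ h}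

theorem pairCount_comp_aut {d N n : ℕ} (f₀ f₁ : (FIG.of d : FIG G) ⟶ FIG.of N) (v : W G N)
    (w : W G n) : pairCount (f₀ ≫ v.hom) (f₁ ≫ v.hom) w = pairCount f₀ f₁ w :=
  Nat.card_congr
    { toFun h := ⟨v.hom ≫ h.1, by simpa using h.2⟩
      invFun h := ⟨v.inv ≫ h.1, by simpa using h.2⟩
      left_inv h := Subtype.ext (by simp)
      right_inv h := Subtype.ext (by simp) }

theorem pairCount_aut_comp {d N n : ℕ} (f₀ f₁ : (FIG.of d : FIG G) ⟶ FIG.of N) (u : W G d)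
    (w : W G n) : pairCount (u.hom ≫ f₀) (u.hom ≫ f₁) w = pairCount f₀ f₁ w := by
  refine Nat.card_congr (Equiv.subtypeEquivRight fun h => ?_)
  constructor
  · intro e
    have := congrArg (fun x => u.inv ≫ x) e
    simpa using this
  · intro e
    simp [e]

theorem pairCount_of_eq {d n : ℕ} (f₀ f₁ : (FIG.of d : FIG G) ⟶ FIG.of d) (w : W G n) :
    pairCount f₀ f₁ w = eqCount (asAut ((asAut f₀).inv ≫ f₁)) w := by
  refine Nat.card_congr (Equiv.subtypeEquivRight fun h => ?_)
  have h₁ := aut_inv_hom_assoc (asAut f₀) (h ≫ w.hom)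
  have h₂ := aut_hom_inv_assoc (asAut f₀) (f₁ ≫ h)
  rw [asAut_hom] at h₁ h₂
  rw [asAut_hom, Category.assoc]
  exact ⟨fun e => by rw [← e, h₁], fun e => by rw [← e, h₂]⟩

theorem exists_factor_of_mem_range {X Y Z : FIG G} (t : X ⟶ Z) (h : Y ⟶ Z)
    (H : ∀ i, ∃ l, h.emb l = t.emb i) : ∃ q : X ⟶ Y, q ≫ h = t := by
  choose l hl using H
  exact ⟨⟨⟨l, fun i j hij => t.emb.injective (by rw [← hl, ← hl, hij])⟩,
    fun i => t.label i * (h.label (l i))⁻¹⟩, hom_ext' hl fun i => by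
      simp only [comp_label]
      exact inv_mul_cancel_right _ _⟩

theorem hom_succ_ext {N : ℕ} {Y : FIG G} {h h' : (FIG.of (N + 1) : FIG G) ⟶ Y}
    (e : incl N ≫ h = incl N ≫ h') (e₁ : h.emb (Fin.last N) = h'.emb (Fin.last N))
    (e₂ : h.label (Fin.last N) = h'.label (Fin.last N)) : h = h' := by
  rw [hom_ext_iff] at e
  refine hom_ext' (fun i => ?_) fun i => ?_
  · induction i using Fin.lastCases with
    | last => exact e₁
    | cast i => exact e.1 i
  · induction i using Fin.lastCases with
    | last => exact e₂
    | cast i =>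
      have := e.2 i
      simp only [comp_label, incl_label, one_mul] at this
      exact this

theorem exists_extend {N : ℕ} {Y : FIG G} (h : (FIG.of N : FIG G) ⟶ Y) (y : Fin Y.card)
    (hy : ∀ i, h.emb i ≠ y) (γ : G) : ∃ h' : (FIG.of (N + 1) : FIG G) ⟶ Y,
      incl N ≫ h' = h ∧ h'.emb (Fin.last N) = y ∧ h'.label (Fin.last N) = γ := by
  refine ⟨⟨⟨Fin.snoc (α := fun _ => Fin Y.card) h.emb y, ?_⟩, Fin.snoc (α := fun _ => G) h.label γ⟩,
    hom_ext' (fun i => ?_) fun i => ?_, ?_, ?_⟩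
  · exact Fin.snoc_injective_iff.2 ⟨h.emb.injective, fun ⟨i, hi⟩ => hy i hi⟩
  · exact Fin.snoc_castSucc (α := fun _ => Fin Y.card) ..
  · exact (one_mul _).trans (Fin.snoc_castSucc (α := fun _ => G) ..)
  · exact Fin.snoc_last (α := fun _ => Fin Y.card) ..
  · exact Fin.snoc_last (α := fun _ => G) ..

theorem card_extensions {N n : ℕ} (h : (FIG.of N : FIG G) ⟶ FIG.of n) :
    Nat.card {h' : (FIG.of (N + 1) : FIG G) ⟶ FIG.of n // incl N ≫ h' = h} =
      (n - N) * Nat.card G := by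
  have hlast (h' : {h' : (FIG.of (N + 1) : FIG G) ⟶ FIG.of n // incl N ≫ h' = h}) :
      ∀ i, h.emb i ≠ h'.1.emb (Fin.last N) := fun i hi => by
    have := (hom_ext_iff.1 h'.2).1 i
    exact (Fin.castSucc_lt_last i).ne (h'.1.emb.injective (this.trans hi))
  let e : {h' : (FIG.of (N + 1) : FIG G) ⟶ FIG.of n // incl N ≫ h' = h} ≃
      {y : Fin n // ∀ i, h.emb i ≠ y} × G := Equiv.ofBijective
    (fun h' => (⟨h'.1.emb (Fin.last N), hlast h'⟩, h'.1.label (Fin.last N))) <| by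
      constructor
      · intro h₁ h₂ e
        simp only [Prod.mk.injEq, Subtype.mk.injEq] at e
        exact Subtype.ext (hom_succ_ext (h₁.2.trans h₂.2.symm) e.1 e.2)
      · rintro ⟨⟨y, hy⟩, γ⟩
        obtain ⟨h', h1, h2, h3⟩ := exists_extend h y hy γ
        exact ⟨⟨h', h1⟩, Prod.ext (Subtype.ext h2) h3⟩
  rw [Nat.card_congr e, Nat.card_prod]
  congr 1
  have h1 : Nat.card {y : Fin n // ¬ ∃ i, h.emb i = y} + Nat.card {y : Fin n // ∃ i, h.emb i = y} =
      n := by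
    classical
    rw [Nat.card_eq_fintype_card, Nat.card_eq_fintype_card, Fintype.card_subtype_compl]
    have := Fintype.card_subtype_le fun y : Fin n => ∃ i, h.emb i = y
    simp only [Fintype.card_fin] at this ⊢
    omega
  have h2 : Nat.card {y : Fin n // ∃ i, h.emb i = y} = N := by
    have := Nat.card_congr (Equiv.ofInjective _ h.emb.injective)
    rw [Nat.card_eq_fintype_card (α := Fin _), Fintype.card_fin] at this
    exact this.symm
  have h3 : Nat.card {y : Fin n // ∀ i, h.emb i ≠ y} =
      Nat.card {y : Fin n // ¬ ∃ i, h.emb i = y} :=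
    Nat.card_congr (Equiv.subtypeEquivRight fun y => by simp)
  omega

/-- A point that occurs in neither `f₀` nor `f₁` can be placed anywhere. -/
theorem pairCount_comp_incl [Finite G] {d N n : ℕ} (g₀ g₁ : (FIG.of d : FIG G) ⟶ FIG.of N)
    (w : W G n) : pairCount (g₀ ≫ incl N) (g₁ ≫ incl N) w =
      ((n - N) * Nat.card G) * pairCount g₀ g₁ w := by
  classical
  let e : {h : (FIG.of (N + 1) : FIG G) ⟶ FIG.of n //
      (g₀ ≫ incl N) ≫ h ≫ w.hom = (g₁ ≫ incl N) ≫ h} ≃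
      Σ h : {h : (FIG.of N : FIG G) ⟶ FIG.of n // g₀ ≫ h ≫ w.hom = g₁ ≫ h},
        {h' : (FIG.of (N + 1) : FIG G) ⟶ FIG.of n // incl N ≫ h' = h.1} :=
    { toFun h := ⟨⟨incl N ≫ h.1, by simpa using h.2⟩, ⟨h.1, rfl⟩⟩
      invFun p := ⟨p.2.1, by
        have := p.1.2
        rw [← p.2.2] at this
        simpa using this⟩
      left_inv _ := rfl
      right_inv := by
        rintro ⟨⟨h, hh⟩, ⟨h', e⟩⟩
        dsimp only at e
        subst e
        rfl }
  rw [pairCount, Nat.card_congr e, Nat.card_sigma, Finset.sum_congr rfl fun h _ =>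
    card_extensions h.1, Finset.sum_const, Finset.card_univ, pairCount, smul_eq_mul, mul_comm]
  congr 1
  exact Nat.card_eq_fintype_card.symm

open Classical in
/-- Suppose that the last point of `[N + 1]` is not in the image of `f₀ = g₀ ≫ incl N`, and is the
image of the last point under `f₁`. If `h` is counted by `pairCount f₀ f₁ w`, its value at the last
point is determined by its restriction `h'` to `[N]`: it is the image of the last point under
`g₀ ≫ h' ≫ w`. Conversely, this value is admissible unless `h'` takes it already, in which case `h'`
is counted by `pairCount g₀ q w` for exactly one extension `q` of `g₁`. -/
theorem pairCount_add_sum [Finite G] {d N n : ℕ} (g₀ : (FIG.of (d + 1) : FIG G) ⟶ FIG.of N)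
    (f₁ : (FIG.of (d + 1) : FIG G) ⟶ FIG.of (N + 1)) (hf₁ : f₁.emb (Fin.last d) = Fin.last N)
    (g₁ : (FIG.of d : FIG G) ⟶ FIG.of N) (hg₁ : incl d ≫ f₁ = g₁ ≫ incl N) (w : W G n) :
    pairCount (g₀ ≫ incl N) f₁ w +
      ∑ q : {q : (FIG.of (d + 1) : FIG G) ⟶ FIG.of N // incl d ≫ q = g₁}, pairCount g₀ q.1 w =
    pairCount (incl d ≫ g₀) g₁ w := by
  classical
  have hq : ∀ (h : (FIG.of (N + 1) : FIG G) ⟶ FIG.of n), (g₀ ≫ incl N) ≫ h ≫ w.hom = f₁ ≫ h →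
      (incl d ≫ g₀) ≫ (incl N ≫ h) ≫ w.hom = g₁ ≫ incl N ≫ h := by
    intro h e
    have := congrArg (fun x => incl d ≫ x) e
    simp only [← Category.assoc] at this ⊢
    rw [this, hg₁]
  let e : ({h : (FIG.of (N + 1) : FIG G) ⟶ FIG.of n // (g₀ ≫ incl N) ≫ h ≫ w.hom = f₁ ≫ h} ⊕
      Σ q : {q : (FIG.of (d + 1) : FIG G) ⟶ FIG.of N // incl d ≫ q = g₁},
        {h : (FIG.of N : FIG G) ⟶ FIG.of n // g₀ ≫ h ≫ w.hom = q.1 ≫ h}) →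
      {h : (FIG.of N : FIG G) ⟶ FIG.of n // (incl d ≫ g₀) ≫ h ≫ w.hom = g₁ ≫ h} :=
    Sum.elim (fun h => ⟨incl N ≫ h.1, hq h.1 h.2⟩) fun p => ⟨p.2.1, by
      rw [Category.assoc, p.2.2, ← Category.assoc, p.1.2]⟩
  have he : Function.Bijective e := by
    constructor
    · -- for `h` extending `h'`, `f₁ ≫ h` does not factor through `h'`
      have key : ∀ (h : (FIG.of (N + 1) : FIG G) ⟶ FIG.of n)
          (q : (FIG.of (d + 1) : FIG G) ⟶ FIG.of N),
          (g₀ ≫ incl N) ≫ h ≫ w.hom = f₁ ≫ h → g₀ ≫ (incl N ≫ h) ≫ w.hom = q ≫ incl N ≫ h →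
          False := by
        intro h q h1 h2
        have h3 : f₁ ≫ h = (q ≫ incl N) ≫ h := by
          rw [← h1, Category.assoc, Category.assoc, ← h2, Category.assoc]
        have h4 := (hom_ext_iff.1 (cancel_right h3)).1 (Fin.last d)
        exact incl_ne_last q _ (h4.symm.trans hf₁)
      rintro (⟨h, hh⟩ | ⟨⟨q, hq⟩, h, hh⟩) (⟨h', hh'⟩ | ⟨⟨q', hq'⟩, h', hh'⟩) E
      · have E' : incl N ≫ h = incl N ≫ h' := congrArg Subtype.val E
        have h1 : f₁ ≫ h = f₁ ≫ h' := by
          rw [← hh, ← hh', Category.assoc, Category.assoc, ← Category.assoc (incl N), E',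
            Category.assoc]
        have h2 := (hom_ext_iff.1 h1).1 (Fin.last d)
        have h3 := (hom_ext_iff.1 h1).2 (Fin.last d)
        rw [comp_emb, comp_emb, hf₁] at h2
        rw [comp_label, comp_label, hf₁] at h3
        obtain rfl := hom_succ_ext E' h2 (mul_left_cancel h3)
        rfl
      · have E' : incl N ≫ h = h' := congrArg Subtype.val E
        exact (key h q' hh (by rw [E']; exact hh')).elim
      · have E' : h = incl N ≫ h' := congrArg Subtype.val E
        exact (key h' q hh' (by rw [← E']; exact hh)).elim
      · have E' : h = h' := congrArg Subtype.val E
        subst E'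
        obtain rfl : q = q' := cancel_right (hh.symm.trans hh')
        rfl
    · rintro ⟨h', hh'⟩
      by_cases H : ∃ l, h'.emb l = (g₀ ≫ h' ≫ w.hom).emb (Fin.last d)
      · obtain ⟨q, hq⟩ := exists_factor_of_mem_range (g₀ ≫ h' ≫ w.hom) h' fun i => by
          induction i using Fin.lastCases with
          | last => exact H
          | cast i =>
            have := (hom_ext_iff.1 hh').1 i
            exact ⟨g₁.emb i, this.symm⟩
        refine ⟨Sum.inr ⟨⟨q, cancel_right (h := h') ?_⟩, ⟨h', hq.symm⟩⟩, rfl⟩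
        rw [← hh', Category.assoc, hq, Category.assoc]
      · push Not at H
        obtain ⟨h, h1, h2, h3⟩ := exists_extend h' ((g₀ ≫ h' ≫ w.hom).emb (Fin.last d)) H
          ((f₁.label (Fin.last d))⁻¹ * (g₀ ≫ h' ≫ w.hom).label (Fin.last d))
        refine ⟨Sum.inl ⟨h, ?_⟩, Subtype.ext h1⟩
        rw [Category.assoc, ← Category.assoc (incl N), h1]
        refine hom_succ_ext ?_ ?_ ?_
        · rw [← Category.assoc, hh', ← Category.assoc (incl d), hg₁, Category.assoc, h1]
        · rw [comp_emb f₁, hf₁]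
          exact h2.symm
        · rw [comp_label f₁, hf₁]
          refine Eq.symm ((congrArg _ h3).trans ?_)
          exact mul_inv_cancel_left _ _
  rw [pairCount, pairCount, ← Nat.card_congr (Equiv.ofBijective e he), Nat.card_sum,
    Nat.card_sigma]
  rfl

/-- The span of the functions `eqCount u` on `W_n`, for `u ∈ W_a` and `a ≤ s`. -/
noncomputable def countSpan (G k : Type u) [Group G] [Field k] (s n : ℕ) :
    Submodule k (W G n → k) :=
  Submodule.span k (Set.range fun (p : Σ a : Fin (s + 1), W G a) w => (eqCount p.2 w : k))

theorem countSpan_mono {k : Type u} [Field k] {s t : ℕ} (h : s ≤ t) (n : ℕ) :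
    countSpan G k s n ≤ countSpan G k t n := by
  refine Submodule.span_mono ?_
  rintro _ ⟨⟨a, u⟩, rfl⟩
  exact ⟨⟨⟨a, by omega⟩, u⟩, rfl⟩

/-- By induction on `N`, removing a point of `[N]` that is not in the image of `f₀`; if there is
none, then `f₀` is invertible and `pairCount f₀ f₁` is one of the spanning functions. -/
theorem pairCount_mem_countSpan [Finite G] {k : Type u} [Field k] (n : ℕ) {N d : ℕ}
    (f₀ f₁ : (FIG.of d : FIG G) ⟶ FIG.of N) :
    (fun w => (pairCount f₀ f₁ w : k)) ∈ countSpan G k d n := by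
  classical
  induction N generalizing d with
  | zero =>
    obtain rfl : d = 0 := Nat.le_zero.1 (card_le_of_hom f₀)
    simp only [pairCount_of_eq]
    exact Submodule.subset_span ⟨⟨⟨0, by omega⟩, _⟩, rfl⟩
  | succ N ih =>
    rcases (card_le_of_hom f₀).eq_or_lt with hd | hd
    · obtain rfl : d = N + 1 := hd
      simp only [pairCount_of_eq]
      exact Submodule.subset_span ⟨⟨⟨N + 1, by omega⟩, _⟩, rfl⟩
    · replace hd : d < N + 1 := hd
      obtain ⟨x, hx⟩ : ∃ x, ∀ i, f₀.emb i ≠ x := by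
        by_contra! H
        have := Fintype.card_le_of_surjective _ H
        simp only [Fintype.card_fin] at this
        omega
      obtain ⟨v, hv⟩ := exists_aut_emb_eq (G := G) x (Fin.last N)
      obtain ⟨g₀, hg₀⟩ := exists_factor (f₀ ≫ v.hom) fun i hi =>
        hx i (v.hom.emb.injective (hi.trans hv.symm))
      simp only [← pairCount_comp_aut f₀ f₁ v]
      rw [hg₀]
      generalize f₁ ≫ v.hom = f₁
      by_cases H : ∃ j, f₁.emb j = Fin.last N
      · obtain ⟨j, hj⟩ := H
        obtain ⟨d, rfl⟩ : ∃ d', d = d' + 1 := ⟨d - 1, by have : j.1 < d := j.2; omega⟩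
        obtain ⟨u, hu⟩ := exists_aut_emb_eq (G := G) (Fin.last d) j
        simp only [← pairCount_aut_comp (g₀ ≫ incl N) f₁ u]
        simp only [← Category.assoc]
        have hf₁ : (u.hom ≫ f₁).emb (Fin.last d) = Fin.last N := by rw [comp_emb, hu, hj]
        generalize u.hom ≫ f₁ = f₁ at hf₁
        generalize u.hom ≫ g₀ = g₀
        obtain ⟨g₁, hg₁⟩ := exists_factor (incl d ≫ f₁) fun i hi =>
          (Fin.castSucc_lt_last i).ne (f₁.emb.injective (hi.trans hf₁.symm))
        have : (fun w : W G n => (pairCount (g₀ ≫ incl N) f₁ w : k)) =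
            (fun w => (pairCount (incl d ≫ g₀) g₁ w : k)) -
              ∑ q : {q : (FIG.of (d + 1) : FIG G) ⟶ FIG.of N // incl d ≫ q = g₁},
                fun w => (pairCount g₀ q.1 w : k) := by
          funext w
          rw [Pi.sub_apply, Finset.sum_apply, ← pairCount_add_sum g₀ f₁ hf₁ g₁ hg₁ w]
          push_cast
          exact (add_sub_cancel_right _ _).symm
        rw [this]
        exact sub_mem (countSpan_mono (Nat.le_succ d) n (ih _ _))
          (sum_mem fun q _ => ih g₀ q.1)
      · push Not at H
        obtain ⟨g₁, rfl⟩ := exists_factor f₁ H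
        have : (fun w : W G n => (pairCount (g₀ ≫ incl N) (g₁ ≫ incl N) w : k)) =
            (((n - N) * Nat.card G : ℕ) : k) • fun w => (pairCount g₀ g₁ w : k) := by
          funext w
          rw [pairCount_comp_incl, Nat.cast_mul, Pi.smul_apply, smul_eq_mul]
        rw [this]
        exact Submodule.smul_mem _ _ (ih g₀ g₁)

end FIG

namespace FIGModule

open FIG

variable {G k : Type u} [Group G] [Field k]

theorem map_id_hom (V : FIGModule G k) (X : FIG G) : (V.map (𝟙 X)).hom = LinearMap.id := by
  ext x
  simp

theorem map_comp_hom (V : FIGModule G k) {X Y Z : FIG G} (f : X ⟶ Y) (g : Y ⟶ Z) :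
    (V.map (f ≫ g)).hom = (V.map g).hom ∘ₗ (V.map f).hom := by
  ext x
  simp

theorem character_conj (V : FIGModule G k) {n : ℕ} [Module.Finite k (V.obj (FIG.of n))] (w u : W G n) :
    LinearMap.trace k _ (V.map (u.hom ≫ w.hom ≫ u.inv)).hom = V.character n w := by
  have h : (V.map u.hom).hom ∘ₗ (V.map u.inv).hom = LinearMap.id := by
    rw [← map_comp_hom, aut_inv_hom, map_id_hom]
  have h' : (V.map (w.hom ≫ u.inv)).hom = (V.map u.inv).hom ∘ₗ (V.map w.hom).hom := map_comp_hom ..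
  rw [map_comp_hom, LinearMap.trace_comp_comm', h', ← LinearMap.comp_assoc, h, LinearMap.id_comp]
  rfl

/-- For every fixed `n`, the character of a module generated in degree `≤ s` is a combination of
the functions `eqCount u` with `u ∈ W_a`, `a ≤ s`. -/
theorem character_mem_countSpan [Finite G] [CharZero k] (V : FIGModule G k)
    (hfin : ∀ n, Module.Finite k (V.obj (FIG.of n))) {s : ℕ} (hV : V.IsGeneratedInDegree s) (n : ℕ) :
    V.character n ∈ countSpan G k s n := by
  classical
  let I := Σ j : Fin (s + 1), ((FIG.of j : FIG G) ⟶ FIG.of n)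
  let π : (∀ p : I, V.obj (FIG.of p.1)) →ₗ[k] V.obj (FIG.of n) :=
    ∑ p : I, (V.map p.2).hom ∘ₗ LinearMap.proj p
  have hπ : LinearMap.range π = ⊤ := by
    rw [eq_top_iff, ← hV n]
    refine Submodule.span_le.2 ?_
    rintro _ ⟨j, x, f, hj, rfl⟩
    let p : I := ⟨⟨j, Nat.lt_succ_of_le hj⟩, f⟩
    refine ⟨Pi.single p x, ?_⟩
    rw [LinearMap.sum_apply, Finset.sum_eq_single p]
    · simp [p]
    · intro q _ hq
      simp [Pi.single_eq_of_ne hq]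
    · simp
  obtain ⟨σ, hσ⟩ := π.exists_rightInverse_of_surjective hπ
  let τ (p : I) : V.obj (FIG.of n) →ₗ[k] V.obj (FIG.of p.1) := LinearMap.proj p ∘ₗ σ
  have hτ : ∑ p : I, (V.map p.2).hom ∘ₗ τ p = LinearMap.id := by
    rw [← hσ]
    ext x
    simp [π, τ]
  have h1 : ∀ f : (FIG.of n : FIG G) ⟶ FIG.of n, LinearMap.trace k _ (V.map f).hom =
      ∑ p : I, LinearMap.trace k _ (τ p ∘ₗ (V.map (p.2 ≫ f)).hom) := fun f => by
    rw [LinearMap.trace_eq_sum_of_sum_comp_eq_id (fun p : I => (V.map p.2).hom) τ hτ]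
    simp only [map_comp_hom]
  -- the character is a class function, hence can be averaged over conjugates
  have h2 : V.character n = (Fintype.card (W G n) : k)⁻¹ • ∑ p : I,
      ∑ f₁ : (FIG.of p.1 : FIG G) ⟶ FIG.of n,
        LinearMap.trace k _ (τ p ∘ₗ (V.map f₁).hom) • fun w => (pairCount p.2 f₁ w : k) := by
    funext w
    have := hfin n
    have h3 : (Fintype.card (W G n) : k) * V.character n w =
        ∑ u : W G n, LinearMap.trace k _ (V.map (u.hom ≫ w.hom ≫ u.inv)).hom := by
      simp only [character_conj, Finset.sum_const, Finset.card_univ, nsmul_eq_mul]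
    rw [Pi.smul_apply, smul_eq_mul, eq_inv_mul_iff_mul_eq₀ (Nat.cast_ne_zero.2 Fintype.card_ne_zero),
      h3, Finset.sum_congr rfl fun u _ => h1 _, Finset.sum_comm, Finset.sum_apply]
    refine Finset.sum_congr rfl fun p _ => ?_
    rw [Finset.sum_apply, ← Finset.sum_fiberwise_of_maps_to (t := Finset.univ)
      (g := fun u : W G n => p.2 ≫ u.hom ≫ w.hom ≫ u.inv) fun _ _ => Finset.mem_univ _]
    refine Finset.sum_congr rfl fun f₁ _ => ?_
    rw [Finset.sum_congr rfl fun u hu => by rw [(Finset.mem_filter.1 hu).2], Finset.sum_const,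
      Pi.smul_apply, nsmul_eq_mul, smul_eq_mul, mul_comm]
    congr 2
    rw [pairCount, ← Fintype.card_subtype, ← Nat.card_eq_fintype_card]
    refine Nat.card_congr (Equiv.subtypeEquiv
      ⟨fun u : W G n => u.hom, asAut, fun u => Iso.ext rfl, fun f => rfl⟩ fun u => ?_)
    change p.2 ≫ u.hom ≫ w.hom ≫ u.inv = f₁ ↔ p.2 ≫ u.hom ≫ w.hom = f₁ ≫ u.hom
    constructor
    · rintro rfl
      simp
    · intro e
      have := congrArg (fun x => x ≫ u.inv) e
      simpa using this
  rw [h2]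
  exact Submodule.smul_mem _ _ (sum_mem fun p _ => sum_mem fun f₁ _ => Submodule.smul_mem _ _
    (countSpan_mono (Nat.le_of_lt_succ p.1.2) n (pairCount_mem_countSpan n p.2 f₁)))

end FIGModule

namespace FIG

open Function

variable {G : Type u} [Group G]

/-! ### Labelled cycles -/

section Cycles

/-- The product `g x * g (a x) * ⋯ * g (a^(j-1) x)` of labels of `w = (a, g)`. -/
def pathLabel {n : ℕ} (w : W G n) (x : Fin n) (j : ℕ) : G :=
  ((List.range j).map fun i => w.hom.label (w.hom.emb^[i] x)).prod

theorem pathLabel_zero {n : ℕ} (w : W G n) (x : Fin n) : pathLabel w x 0 = 1 := rfl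

theorem pathLabel_succ {n : ℕ} (w : W G n) (x : Fin n) (j : ℕ) :
    pathLabel w x (j + 1) = pathLabel w x j * w.hom.label (w.hom.emb^[j] x) := by
  simp [pathLabel, List.range_succ]

theorem pathLabel_succ' {n : ℕ} (w : W G n) (x : Fin n) (j : ℕ) :
    pathLabel w x (j + 1) = w.hom.label x * pathLabel w (w.hom.emb x) j := by
  induction j with
  | zero => simp [pathLabel_succ, pathLabel_zero]
  | succ j ih => rw [pathLabel_succ, ih, pathLabel_succ w (w.hom.emb x), mul_assoc, iterate_succ_apply]

theorem mem_periodicPts {n : ℕ} (w : W G n) (x : Fin n) : x ∈ periodicPts w.hom.emb :=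
  w.hom.emb.injective.mem_periodicPts x

theorem cycleLabel_emb {n : ℕ} (w : W G n) (x : Fin n) :
    cycleLabel w (w.hom.emb x) = cycleLabel w x := by
  change ConjClasses.mk (pathLabel w _ (minimalPeriod w.hom.emb (w.hom.emb x))) =
    ConjClasses.mk (pathLabel w x _)
  rw [minimalPeriod_apply (mem_periodicPts w x), ConjClasses.mk_eq_mk_iff_isConj, isConj_iff]
  refine ⟨w.hom.label x, ?_⟩
  rw [← pathLabel_succ', pathLabel_succ, iterate_minimalPeriod, mul_inv_cancel_right]

theorem cycleLabel_iterate {n : ℕ} (w : W G n) (x : Fin n) (j : ℕ) :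
    cycleLabel w (w.hom.emb^[j] x) = cycleLabel w x := by
  induction j with
  | zero => rfl
  | succ j ih => rw [iterate_succ_apply', cycleLabel_emb, ih]

/-- A cycle of length `i` has `i` elements. -/
theorem card_eq_mul_cycleCount {n : ℕ} (w : W G n) {i : ℕ} (hi : 0 < i) (C : ConjClasses G) :
    Nat.card {x : Fin n // minimalPeriod w.hom.emb x = i ∧ cycleLabel w x = C} =
      i * cycleCount w i C := by
  classical
  let orb (x : Fin n) : Set (Fin n) := {y | ∃ j : ℕ, w.hom.emb^[j] x = y}
  have horb : ∀ x j, orb (w.hom.emb^[j] x) = orb x := by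
    intro x j
    ext y
    constructor
    · rintro ⟨m, rfl⟩
      exact ⟨m + j, iterate_add_apply _ _ _ _⟩
    · rintro ⟨m, rfl⟩
      have hp := minimalPeriod_pos_of_mem_periodicPts (mem_periodicPts w x)
      refine ⟨m + (minimalPeriod w.hom.emb x - 1) * j, ?_⟩
      rw [← iterate_add_apply, add_assoc]
      have : (minimalPeriod w.hom.emb x - 1) * j + j = minimalPeriod w.hom.emb x * j := by
        rw [← Nat.succ_mul, Nat.succ_eq_add_one, Nat.sub_add_cancel hp]
      rw [this, iterate_add_apply]
      congr 1
      exact (isPeriodicPt_minimalPeriod w.hom.emb x).mul_const j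
  let S : Finset (Fin n) :=
    Finset.univ.filter fun x => minimalPeriod w.hom.emb x = i ∧ cycleLabel w x = C
  have hS : ∀ x, x ∈ S ↔ minimalPeriod w.hom.emb x = i ∧ cycleLabel w x = C := fun x => by simp [S]
  have h1 : cycleCount w i C = (S.image orb).card := by
    rw [cycleCount, ← Set.ncard_coe_finset]
    congr 1
    ext c
    simp only [Set.mem_ofPred_eq, Finset.coe_image, Set.mem_image, Finset.mem_coe, hS]
    constructor
    · rintro ⟨x, rfl, h⟩
      exact ⟨x, h, rfl⟩
    · rintro ⟨x, h, rfl⟩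
      exact ⟨x, rfl, h⟩
  have h2 : ∀ c ∈ S.image orb, (S.filter fun x => orb x = c).card = i := by
    intro c hc
    obtain ⟨x, hx, rfl⟩ := Finset.mem_image.1 hc
    rw [hS] at hx
    have : S.filter (fun y => orb y = orb x) = (Finset.range i).image fun j => w.hom.emb^[j] x := by
      ext y
      simp only [Finset.mem_filter, Finset.mem_image, Finset.mem_range]
      constructor
      · rintro ⟨-, hy⟩
        obtain ⟨j, rfl⟩ : y ∈ orb x := hy ▸ ⟨0, rfl⟩
        refine ⟨j % i, Nat.mod_lt _ hi, ?_⟩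
        rw [← hx.1]
        exact iterate_mod_minimalPeriod_eq
      · rintro ⟨j, -, rfl⟩
        refine ⟨(hS _).2 ⟨?_, ?_⟩, horb x j⟩
        · rw [minimalPeriod_apply_iterate (mem_periodicPts w x), hx.1]
        · rw [cycleLabel_iterate, hx.2]
    rw [this, Finset.card_image_of_injOn, Finset.card_range]
    intro j hj j' hj' e
    refine iterate_injOn_Iio_minimalPeriod (f := w.hom.emb) (x := x) ?_ ?_ e
    · simpa [hx.1] using hj
    · simpa [hx.1] using hj'
  have h3 := Finset.card_eq_sum_card_image orb S
  rw [Finset.sum_congr rfl h2, Finset.sum_const, smul_eq_mul, ← h1] at h3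
  rw [mul_comm, ← h3, Nat.card_eq_fintype_card, Fintype.card_subtype]

/-- The standard cycle on `[l + 1]`: the rotation, with labels `1, …, 1, h`. -/
noncomputable def stdCycle (l : ℕ) (h : G) : W G (l + 1) :=
  asAut ⟨(finRotate (l + 1)).toEmbedding, fun i => if i = Fin.last l then h else 1⟩

theorem stdCycle_emb_castSucc (l : ℕ) (h : G) (i : Fin l) :
    (stdCycle l h).hom.emb i.castSucc = i.succ :=
  Fin.ext (by
    change ((finRotate (l + 1)) i.castSucc).val = _
    rw [coe_finRotate_of_ne_last (Fin.castSucc_lt_last i).ne]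
    rfl)

theorem stdCycle_emb_last (l : ℕ) (h : G) : (stdCycle l h).hom.emb (Fin.last l) = 0 :=
  finRotate_last

theorem stdCycle_label_castSucc (l : ℕ) (h : G) (i : Fin l) :
    (stdCycle l h).hom.label i.castSucc = 1 := if_neg (Fin.castSucc_lt_last i).ne

theorem stdCycle_label_last (l : ℕ) (h : G) : (stdCycle l h).hom.label (Fin.last l) = h := if_pos rfl

theorem stdCycle_comp_eq_iff {l n : ℕ} (h : G) (w : W G n)
    (f : (FIG.of (l + 1) : FIG G) ⟶ FIG.of n) :
    (stdCycle l h).hom ≫ f = f ≫ w.hom ↔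
      (∀ i : Fin l, f.emb i.succ = w.hom.emb (f.emb i.castSucc) ∧
        f.label i.succ = f.label i.castSucc * w.hom.label (f.emb i.castSucc)) ∧
      f.emb (0 : Fin (l + 1)) = w.hom.emb (f.emb (Fin.last l)) ∧
      h * f.label (0 : Fin (l + 1)) = f.label (Fin.last l) * w.hom.label (f.emb (Fin.last l)) := by
  have e₁ : ∀ i : Fin l, ((stdCycle l h).hom ≫ f).emb i.castSucc = f.emb i.succ := fun i =>
    congrArg f.emb (stdCycle_emb_castSucc l h i)
  have e₂ : ∀ i : Fin l, ((stdCycle l h).hom ≫ f).label i.castSucc = f.label i.succ := fun i =>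
    (congrArg₂ _ (stdCycle_label_castSucc l h i)
      (congrArg f.label (stdCycle_emb_castSucc l h i))).trans (one_mul _)
  have e₃ : ((stdCycle l h).hom ≫ f).emb (Fin.last l) = f.emb (0 : Fin (l + 1)) :=
    congrArg f.emb (stdCycle_emb_last l h)
  have e₄ : ((stdCycle l h).hom ≫ f).label (Fin.last l) = h * f.label (0 : Fin (l + 1)) :=
    congrArg₂ _ (stdCycle_label_last l h) (congrArg f.label (stdCycle_emb_last l h))
  rw [hom_ext_iff]
  constructor
  · rintro ⟨h1, h2⟩
    exact ⟨fun i => ⟨(e₁ i).symm.trans (h1 _), (e₂ i).symm.trans (h2 _)⟩, e₃.symm.trans (h1 _),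
      e₄.symm.trans (h2 _)⟩
  · rintro ⟨h1, h2, h3⟩
    refine ⟨fun i => ?_, fun i => ?_⟩
    · induction i using Fin.lastCases with
      | last => exact e₃.trans h2
      | cast i => exact (e₁ i).trans (h1 i).1
    · induction i using Fin.lastCases with
      | last => exact e₄.trans h3
      | cast i => exact (e₂ i).trans (h1 i).2

theorem emb_label_of_stdCycle_comp_eq {l n : ℕ} {h : G} {w : W G n}
    {f : (FIG.of (l + 1) : FIG G) ⟶ FIG.of n} (hf : (stdCycle l h).hom ≫ f = f ≫ w.hom) (i : ℕ)
    (hi : i < l + 1) : f.emb (⟨i, hi⟩ : Fin (l + 1)) = w.hom.emb^[i] (f.emb (0 : Fin (l + 1))) ∧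
      f.label (⟨i, hi⟩ : Fin (l + 1)) =
        f.label (0 : Fin (l + 1)) * pathLabel w (f.emb (0 : Fin (l + 1))) i := by
  rw [stdCycle_comp_eq_iff] at hf
  induction i with
  | zero => exact ⟨rfl, by rw [pathLabel_zero, mul_one]; rfl⟩
  | succ i ih =>
    obtain ⟨h1, h2⟩ := ih (by omega)
    obtain ⟨h3, h4⟩ := hf.1 ⟨i, by omega⟩
    refine ⟨h3.trans ?_, h4.trans ?_⟩
    · rw [iterate_succ_apply']
      exact congrArg _ h1
    · rw [pathLabel_succ, ← mul_assoc]
      exact congrArg₂ _ h2 (congrArg _ h1)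

/-- A morphism from the standard cycle to `w` is given by the image of the point `0`, which lies on
a cycle of the same length, and by its label. -/
noncomputable def stdCycleHomEquiv {l n : ℕ} (h : G) (w : W G n) :
    {f : (FIG.of (l + 1) : FIG G) ⟶ FIG.of n // (stdCycle l h).hom ≫ f = f ≫ w.hom} ≃
      {p : Fin n × G // minimalPeriod w.hom.emb p.1 = l + 1 ∧
        h * p.2 = p.2 * pathLabel w p.1 (l + 1)} :=
  Equiv.ofBijective (fun f => ⟨(f.1.emb (0 : Fin (l + 1)), f.1.label (0 : Fin (l + 1))), by
    obtain ⟨f, hf⟩ := f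
    have hi := emb_label_of_stdCycle_comp_eq hf
    obtain ⟨h1, h2⟩ := hi l (Nat.lt_succ_self l)
    obtain ⟨-, h3, h4⟩ := (stdCycle_comp_eq_iff h w f).1 hf
    have h5 : IsPeriodicPt w.hom.emb (l + 1) (f.emb (0 : Fin (l + 1))) := by
      rw [IsPeriodicPt, IsFixedPt, iterate_succ_apply', ← h1]
      exact h3.symm
    constructor
    · refine le_antisymm (h5.minimalPeriod_le (Nat.succ_pos l)) ?_
      by_contra! hlt
      have hpos := h5.minimalPeriod_pos (Nat.succ_pos l)
      have h6 := (hi _ hlt).1.trans iterate_minimalPeriod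
      have h7 := congrArg Fin.val (f.emb.injective h6)
      exact hpos.ne' h7
    · rw [pathLabel_succ, ← mul_assoc, ← h2, ← h1]
      exact h4⟩) <| by
    constructor
    · rintro ⟨f, hf⟩ ⟨f', hf'⟩ e
      simp only [Subtype.mk.injEq, Prod.mk.injEq] at e
      refine Subtype.ext (hom_ext' (fun i => ?_) fun i => ?_)
      · have := (emb_label_of_stdCycle_comp_eq hf i.1 i.2).1
        exact this.trans ((congrArg _ e.1).trans (emb_label_of_stdCycle_comp_eq hf' i.1 i.2).1.symm)
      · have := (emb_label_of_stdCycle_comp_eq hf i.1 i.2).2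
        refine this.trans (Eq.trans ?_ (emb_label_of_stdCycle_comp_eq hf' i.1 i.2).2.symm)
        rw [e.1, e.2]
    · rintro ⟨⟨x, η⟩, h1, h2⟩
      dsimp only at h1 h2
      refine ⟨⟨⟨⟨fun i : Fin (l + 1) => w.hom.emb^[i.1] x, fun i j e => Fin.ext ?_⟩,
        fun i : Fin (l + 1) => η * pathLabel w x i.1⟩, ?_⟩, ?_⟩
      · exact iterate_injOn_Iio_minimalPeriod (f := w.hom.emb) (x := x)
          (by rw [h1]; exact i.2) (by rw [h1]; exact j.2) e
      · rw [stdCycle_comp_eq_iff]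
        refine ⟨fun i => ⟨?_, ?_⟩, ?_, ?_⟩
        · exact iterate_succ_apply' _ _ _
        · change η * pathLabel w x (i.1 + 1) = η * pathLabel w x i.1 * w.hom.label (w.hom.emb^[i.1] x)
          rw [pathLabel_succ, mul_assoc]
        · change x = w.hom.emb (w.hom.emb^[l] x)
          have h3 : w.hom.emb^[minimalPeriod w.hom.emb x] x = x := iterate_minimalPeriod
          rw [h1, iterate_succ_apply'] at h3
          exact h3.symm
        · change h * (η * pathLabel w x 0) = η * pathLabel w x l * w.hom.label (w.hom.emb^[l] x)
          rw [pathLabel_zero, mul_one, mul_assoc, ← pathLabel_succ, h2]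
      · refine Subtype.ext (Prod.ext rfl ?_)
        change η * pathLabel w x 0 = η
        rw [pathLabel_zero, mul_one]

/-- For a single cycle, `eqCount` is a multiple of the labelled cycle count. -/
theorem eqCount_stdCycle [Finite G] {l n : ℕ} (h : G) (w : W G n) :
    eqCount (stdCycle l h) w =
      (Nat.card {η : G // h * η = η * h} * (l + 1)) * cycleCount w (l + 1) (ConjClasses.mk h) := by
  classical
  have := Fintype.ofFinite G
  have hlab : ∀ x, minimalPeriod w.hom.emb x = l + 1 →
      cycleLabel w x = ConjClasses.mk (pathLabel w x (l + 1)) := by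
    intro x hx
    rw [← hx]
    rfl
  let e : {p : Fin n × G // minimalPeriod w.hom.emb p.1 = l + 1 ∧
        h * p.2 = p.2 * pathLabel w p.1 (l + 1)} ≃
      Σ x : {x : Fin n // minimalPeriod w.hom.emb x = l + 1 ∧ cycleLabel w x = ConjClasses.mk h},
        {η : G // h * η = η * pathLabel w x.1 (l + 1)} :=
    { toFun p := ⟨⟨p.1.1, p.2.1, by
        rw [hlab _ p.2.1, ConjClasses.mk_eq_mk_iff_isConj, isConj_iff]
        exact ⟨p.1.2, by rw [← p.2.2, mul_inv_cancel_right]⟩⟩, p.1.2, p.2.2⟩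
      invFun q := ⟨(q.1.1, q.2.1), q.1.2.1, q.2.2⟩
      left_inv _ := rfl
      right_inv _ := rfl }
  rw [eqCount, Nat.card_congr ((stdCycleHomEquiv h w).trans e), Nat.card_sigma]
  have h1 : ∀ x : {x : Fin n // minimalPeriod w.hom.emb x = l + 1 ∧
      cycleLabel w x = ConjClasses.mk h},
      Nat.card {η : G // h * η = η * pathLabel w x.1 (l + 1)} =
        Nat.card {η : G // h * η = η * h} := by
    rintro ⟨x, hx, hx'⟩
    rw [hlab x hx, ConjClasses.mk_eq_mk_iff_isConj, isConj_iff] at hx'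
    obtain ⟨c, hc⟩ := hx'
    refine Nat.card_congr (Equiv.subtypeEquiv (Equiv.mulRight c⁻¹) fun η => ?_)
    simp only [Equiv.coe_mulRight, ← hc]
    constructor
    · intro e
      rw [← mul_assoc, e]
      group
    · intro e
      have := congrArg (fun y => y * c) e
      simpa [mul_assoc] using this
  rw [Finset.sum_congr rfl fun x _ => h1 x, Finset.sum_const, Finset.card_univ, smul_eq_mul,
    ← Nat.card_eq_fintype_card, card_eq_mul_cycleCount w (Nat.succ_pos l), Nat.succ_eq_add_one]
  ring

end Cycles

/-! ### Splitting off a cycle -/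

section Split

variable {a b l n : ℕ} {f : (FIG.of b : FIG G) ⟶ FIG.of a} {g : (FIG.of l : FIG G) ⟶ FIG.of a}

theorem hom_ext_of_cover (hcov : ∀ x, (∃ i, f.emb i = x) ∨ ∃ i, g.emb i = x) {Y : FIG G}
    {ψ ψ' : FIG.of a ⟶ Y} (h₁ : f ≫ ψ = f ≫ ψ') (h₂ : g ≫ ψ = g ≫ ψ') : ψ = ψ' := by
  rw [hom_ext_iff] at h₁ h₂
  refine hom_ext' (fun x => ?_) fun x => ?_
  · rcases hcov x with ⟨i, rfl⟩ | ⟨i, rfl⟩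
    exacts [h₁.1 i, h₂.1 i]
  · rcases hcov x with ⟨i, rfl⟩ | ⟨i, rfl⟩
    exacts [mul_left_cancel (h₁.2 i), mul_left_cancel (h₂.2 i)]

/-- Morphisms on complementary parts of `[a]` with disjoint images combine to a morphism on `[a]`. -/
theorem exists_glue (hdisj : ∀ i j, f.emb i ≠ g.emb j)
    (hcov : ∀ x, (∃ i, f.emb i = x) ∨ ∃ i, g.emb i = x) {Y : FIG G}
    (φ : FIG.of b ⟶ Y) (γ : FIG.of l ⟶ Y) (h : ∀ i j, φ.emb i ≠ γ.emb j) :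
    ∃ ψ : FIG.of a ⟶ Y, f ≫ ψ = φ ∧ g ≫ ψ = γ := by
  let e : Fin b ⊕ Fin l ≃ Fin a := Equiv.ofBijective (Sum.elim f.emb g.emb)
    ⟨f.emb.injective.sumElim g.emb.injective hdisj, fun x => by
      rcases hcov x with ⟨i, hi⟩ | ⟨i, hi⟩
      exacts [⟨Sum.inl i, hi⟩, ⟨Sum.inr i, hi⟩]⟩
  have he₁ : ∀ i, e.symm (f.emb i) = Sum.inl i := fun i => e.symm_apply_apply (Sum.inl i)
  have he₂ : ∀ i, e.symm (g.emb i) = Sum.inr i := fun i => e.symm_apply_apply (Sum.inr i)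
  refine ⟨⟨⟨fun x => Sum.elim φ.emb γ.emb (e.symm x),
    (φ.emb.injective.sumElim γ.emb.injective h).comp e.symm.injective⟩,
    fun x => Sum.elim (fun i => (f.label i)⁻¹ * φ.label i) (fun i => (g.label i)⁻¹ * γ.label i)
      (e.symm x)⟩, hom_ext' (fun i => ?_) fun i => ?_, hom_ext' (fun i => ?_) fun i => ?_⟩
  · exact congrArg (Sum.elim φ.emb γ.emb) (he₁ i)
  · refine (congrArg (fun y => f.label i * y) (congrArg (Sum.elim (fun i => (f.label i)⁻¹ * φ.label i)
      (fun i => (g.label i)⁻¹ * γ.label i)) (he₁ i))).trans ?_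
    exact mul_inv_cancel_left _ _
  · exact congrArg (Sum.elim φ.emb γ.emb) (he₂ i)
  · refine (congrArg (fun y => g.label i * y) (congrArg (Sum.elim (fun i => (f.label i)⁻¹ * φ.label i)
      (fun i => (g.label i)⁻¹ * γ.label i)) (he₂ i))).trans ?_
    exact mul_inv_cancel_left _ _

end Split

/-- If a morphism from the standard cycle meets the image of an equivariant morphism `φ`, it is
contained in it. -/
theorem exists_factor_stdCycle {b l n : ℕ} {h : G} {u : W G b} {w : W G n}
    {φ : (FIG.of b : FIG G) ⟶ FIG.of n} (hφ : u.hom ≫ φ = φ ≫ w.hom)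
    {γ : (FIG.of (l + 1) : FIG G) ⟶ FIG.of n} (hγ : (stdCycle l h).hom ≫ γ = γ ≫ w.hom)
    {i₀ : Fin b} {j₀ : Fin (l + 1)} (h₀ : φ.emb i₀ = γ.emb j₀) :
    ∃ q : (FIG.of (l + 1) : FIG G) ⟶ FIG.of b,
      (stdCycle l h).hom ≫ q = q ≫ u.hom ∧ q ≫ φ = γ := by
  have hφ' : ∀ (j : ℕ) i, ∃ i', φ.emb i' = w.hom.emb^[j] (φ.emb i) := by
    intro j
    induction j with
    | zero => exact fun i => ⟨i, rfl⟩
    | succ j ih =>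
      intro i
      obtain ⟨i', hi'⟩ := ih i
      refine ⟨u.hom.emb i', ?_⟩
      rw [iterate_succ_apply', ← hi']
      exact (hom_ext_iff.1 hφ).1 i'
  have hγ' := fun j => (emb_label_of_stdCycle_comp_eq hγ j)
  have hper := (stdCycleHomEquiv h w ⟨γ, hγ⟩).2.1
  -- the image of the point `0` also lies in the image of `φ`
  have h1 : ∃ i', φ.emb i' = γ.emb (0 : Fin (l + 1)) := by
    obtain ⟨i', hi'⟩ := hφ' (l + 1 - j₀.1) i₀
    refine ⟨i', hi'.trans ?_⟩
    rw [h₀]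
    have h2 := (hγ' j₀.1 j₀.2).1
    refine (congrArg _ h2).trans ?_
    rw [← iterate_add_apply, Nat.sub_add_cancel j₀.2.le]
    refine (congrArg (fun i => w.hom.emb^[i] (γ.emb (0 : Fin (l + 1)))) hper.symm).trans ?_
    exact iterate_minimalPeriod
  obtain ⟨i₁, hi₁⟩ := h1
  obtain ⟨q, hq⟩ := exists_factor_of_mem_range γ φ fun j => by
    obtain ⟨i', hi'⟩ := hφ' j.1 i₁
    exact ⟨i', hi'.trans (by rw [hi₁]; exact ((hγ' j.1 j.2).1).symm)⟩
  refine ⟨q, cancel_right (h := φ) ?_, hq⟩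
  rw [Category.assoc, hq, hγ, Category.assoc, hφ, ← Category.assoc, hq]

/-- If `u` is the disjoint union of `u'` and a standard cycle, then the morphisms from `u` to `w`
are the pairs of morphisms from `u'` and from the cycle with disjoint images; in the other
pairs, the cycle maps to `u'`. -/
theorem eqCount_add_mul [Finite G] {a b l n : ℕ} {u : W G a} {u' : W G b} {h : G}
    {f : (FIG.of b : FIG G) ⟶ FIG.of a} {g : (FIG.of (l + 1) : FIG G) ⟶ FIG.of a}
    (hf : u'.hom ≫ f = f ≫ u.hom) (hg : (stdCycle l h).hom ≫ g = g ≫ u.hom)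
    (hdisj : ∀ i j, f.emb i ≠ g.emb j) (hcov : ∀ x, (∃ i, f.emb i = x) ∨ ∃ i, g.emb i = x)
    (w : W G n) :
    eqCount u w + eqCount u' w * eqCount (stdCycle l h) u' =
      eqCount u' w * eqCount (stdCycle l h) w := by
  let e : ({ψ : (FIG.of a : FIG G) ⟶ FIG.of n // u.hom ≫ ψ = ψ ≫ w.hom} ⊕
      {φ : (FIG.of b : FIG G) ⟶ FIG.of n // u'.hom ≫ φ = φ ≫ w.hom} ×
      {q : (FIG.of (l + 1) : FIG G) ⟶ FIG.of b // (stdCycle l h).hom ≫ q = q ≫ u'.hom}) →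
      {φ : (FIG.of b : FIG G) ⟶ FIG.of n // u'.hom ≫ φ = φ ≫ w.hom} ×
      {γ : (FIG.of (l + 1) : FIG G) ⟶ FIG.of n // (stdCycle l h).hom ≫ γ = γ ≫ w.hom} :=
    Sum.elim (fun ψ => (⟨f ≫ ψ.1, by rw [← Category.assoc, hf, Category.assoc, ψ.2, Category.assoc]⟩,
        ⟨g ≫ ψ.1, by rw [← Category.assoc, hg, Category.assoc, ψ.2, Category.assoc]⟩))
      fun p => (p.1, ⟨p.2.1 ≫ p.1.1, by
        rw [← Category.assoc, p.2.2, Category.assoc, p.1.2, Category.assoc]⟩)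
  have he : Function.Bijective e := by
    constructor
    · have key : ∀ (ψ : (FIG.of a : FIG G) ⟶ FIG.of n) (q : (FIG.of (l + 1) : FIG G) ⟶ FIG.of b),
          g ≫ ψ = q ≫ f ≫ ψ → False := by
        intro ψ q E
        rw [← Category.assoc] at E
        have := (hom_ext_iff.1 (cancel_right E)).1 (0 : Fin (l + 1))
        exact hdisj _ _ this.symm
      rintro (⟨ψ, hψ⟩ | ⟨⟨φ, hφ⟩, q, hq⟩) (⟨ψ', hψ'⟩ | ⟨⟨φ', hφ'⟩, q', hq'⟩) E
      · obtain rfl := hom_ext_of_cover hcov (congrArg (fun p => p.1.1) E) (congrArg (fun p => p.2.1) E)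
        rfl
      · have E₁ : f ≫ ψ = φ' := congrArg (fun p => p.1.1) E
        have E₂ : g ≫ ψ = q' ≫ φ' := congrArg (fun p => p.2.1) E
        exact (key ψ q' (by rw [E₁, E₂])).elim
      · have E₁ : φ = f ≫ ψ' := congrArg (fun p => p.1.1) E
        have E₂ : q ≫ φ = g ≫ ψ' := congrArg (fun p => p.2.1) E
        exact (key ψ' q (by rw [← E₁, E₂])).elim
      · have E₁ : φ = φ' := congrArg (fun p => p.1.1) E
        have E₂ : q ≫ φ = q' ≫ φ' := congrArg (fun p => p.2.1) E
        subst E₁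
        obtain rfl := cancel_right E₂
        rfl
    · rintro ⟨⟨φ, hφ⟩, γ, hγ⟩
      by_cases H : ∃ i j, φ.emb i = γ.emb j
      · obtain ⟨i, j, hij⟩ := H
        obtain ⟨q, hq, rfl⟩ := exists_factor_stdCycle hφ hγ hij
        exact ⟨Sum.inr (⟨φ, hφ⟩, ⟨q, hq⟩), rfl⟩
      · push Not at H
        obtain ⟨ψ, rfl, rfl⟩ := exists_glue hdisj hcov φ γ H
        refine ⟨Sum.inl ⟨ψ, hom_ext_of_cover hcov ?_ ?_⟩, rfl⟩
        · rw [← Category.assoc, ← hf, Category.assoc, hφ, Category.assoc]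
        · rw [← Category.assoc, ← hg, Category.assoc, hγ, Category.assoc]
  have h1 := Nat.card_congr (Equiv.ofBijective e he)
  rwa [Nat.card_sum, Nat.card_prod, Nat.card_prod] at h1

/-- Every `u ∈ W_{a+1}` is, up to conjugation, the disjoint union of a standard cycle and an element
of a smaller wreath product. -/
theorem exists_split {a : ℕ} (u : W G (a + 1)) :
    ∃ (b l : ℕ) (u' : W G b) (h : G) (f : (FIG.of b : FIG G) ⟶ FIG.of (a + 1))
      (g : (FIG.of (l + 1) : FIG G) ⟶ FIG.of (a + 1)), b + (l + 1) = a + 1 ∧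
      u'.hom ≫ f = f ≫ u.hom ∧ (stdCycle l h).hom ≫ g = g ≫ u.hom ∧
      (∀ i j, f.emb i ≠ g.emb j) ∧ ∀ x, (∃ i, f.emb i = x) ∨ ∃ i, g.emb i = x := by
  classical
  let x₀ : Fin (a + 1) := 0
  obtain ⟨l, hl⟩ : ∃ l, minimalPeriod u.hom.emb x₀ = l + 1 :=
    ⟨_, (Nat.succ_pred_eq_of_pos
      (minimalPeriod_pos_of_mem_periodicPts (mem_periodicPts u x₀))).symm⟩
  let h := pathLabel u x₀ (l + 1)
  obtain ⟨g, hg⟩ := (stdCycleHomEquiv (l := l) h u).symm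
    ⟨(x₀, 1), hl, by change h * 1 = 1 * h; rw [mul_one, one_mul]⟩
  let R : Finset (Fin (a + 1)) := Finset.univ.map g.emb
  have hR : ∀ x, x ∈ R ↔ ∃ i, g.emb i = x := fun x => by simp [R]
  have hRcard : R.card = l + 1 := by simp [R]
  have hRc : Rᶜ.card + (l + 1) = a + 1 := by
    have h1 := Finset.card_compl_add_card R
    rw [hRcard, Fintype.card_fin] at h1
    exact h1
  let ι : Fin Rᶜ.card ↪ Fin (a + 1) := (Rᶜ.orderEmbOfFin rfl).toEmbedding
  have hι : ∀ x, (∃ i, ι i = x) ↔ x ∉ R := by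
    intro x
    have := Finset.range_orderEmbOfFin Rᶜ rfl
    rw [← Finset.mem_compl, ← Finset.mem_coe, ← this]
    rfl
  let f : (FIG.of Rᶜ.card : FIG G) ⟶ FIG.of (a + 1) := ⟨ι, fun _ => 1⟩
  -- `u` preserves the image of `g`, hence its complement
  have hgsurj : ∀ x, (u.hom.emb x ∈ R) → x ∈ R := by
    intro x hx
    obtain ⟨i, hi⟩ := (hR _).1 hx
    obtain ⟨j, hj⟩ := (emb_bijective (stdCycle l h).hom).2 i
    have h1 := (hom_ext_iff.1 hg).1 j
    rw [comp_emb, comp_emb, hj, hi] at h1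
    exact (hR _).2 ⟨j, (u.hom.emb.injective h1).symm⟩
  obtain ⟨q, hq⟩ := exists_factor_of_mem_range (f ≫ u.hom) f fun i =>
    (hι _).2 fun hx => (hι _).1 ⟨i, rfl⟩ (hgsurj _ hx)
  refine ⟨Rᶜ.card, l, asAut q, h, f, g, hRc, hq, hg, fun i j e => ?_, fun x => ?_⟩
  · exact (hι _).1 ⟨i, rfl⟩ ((hR _).2 ⟨j, e.symm⟩)
  · by_cases hx : x ∈ R
    · exact Or.inr ((hR x).1 hx)
    · exact Or.inl ((hι x).2 hx)

end FIG

namespace FIG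

variable {G : Type u} [Group G]

/-! ### Polynomials in the cycle counts -/

/-- The polynomials in the variables `X_i^C` of degree `≤ m`, where `X_i^C` has degree `i`. -/
noncomputable def cyclePoly (G k : Type u) [Group G] [Field k] (m : ℕ) :
    Submodule k (MvPolynomial (ℕ+ × ConjClasses G) k) :=
  MvPolynomial.restrictSupport k
    {d | Finsupp.weight (fun q : ℕ+ × ConjClasses G => (q.1 : ℕ)) d ≤ m}

/-- The value of a polynomial at the cycle counts of `w`. -/
noncomputable def evalCycles {k : Type u} [Field k] {n : ℕ} (w : W G n) :
    MvPolynomial (ℕ+ × ConjClasses G) k →+* k :=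
  MvPolynomial.eval fun q => (cycleCount w (q.1 : ℕ) q.2 : k)

section

variable {k : Type u} [Field k] {m m' : ℕ}

theorem mem_cyclePoly_iff {P : MvPolynomial (ℕ+ × ConjClasses G) k} :
    P ∈ cyclePoly G k m ↔
      ∀ d ∈ P.support, Finsupp.weight (fun q : ℕ+ × ConjClasses G => (q.1 : ℕ)) d ≤ m :=
  MvPolynomial.mem_restrictSupport_iff k

theorem cyclePoly_mono (h : m ≤ m') : cyclePoly G k m ≤ cyclePoly G k m' :=
  MvPolynomial.restrictSupport_mono _ fun _ hd => le_trans hd h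

theorem C_mem_cyclePoly (c : k) : MvPolynomial.C c ∈ cyclePoly G k m :=
  (MvPolynomial.monomial_mem_restrictSupport k).2 (Or.inl (by simp))

theorem X_mem_cyclePoly (q : ℕ+ × ConjClasses G) :
    (MvPolynomial.X q : MvPolynomial _ k) ∈ cyclePoly G k q.1 :=
  (MvPolynomial.monomial_mem_restrictSupport k).2 (Or.inl (by simp [Finsupp.weight_single]))

theorem mul_mem_cyclePoly {P P' : MvPolynomial (ℕ+ × ConjClasses G) k} (h : P ∈ cyclePoly G k m)
    (h' : P' ∈ cyclePoly G k m') : P * P' ∈ cyclePoly G k (m + m') := by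
  classical
  rw [mem_cyclePoly_iff] at *
  intro d hd
  obtain ⟨e, he, e', he', rfl⟩ := Finset.mem_add.1 (MvPolynomial.support_mul _ _ hd)
  rw [map_add]
  exact add_le_add (h e he) (h' e' he')

theorem weightedTotalDegree_le_of_mem_cyclePoly {P : MvPolynomial (ℕ+ × ConjClasses G) k}
    (h : P ∈ cyclePoly G k m) :
    MvPolynomial.weightedTotalDegree (fun q : ℕ+ × ConjClasses G => (q.1 : ℕ)) P ≤ m :=
  Finset.sup_le (mem_cyclePoly_iff.1 h)

theorem totalDegree_le_of_mem_cyclePoly {P : MvPolynomial (ℕ+ × ConjClasses G) k}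
    (h : P ∈ cyclePoly G k m) : P.totalDegree ≤ m := by
  refine Finset.sup_le fun d hd => le_trans ?_ (mem_cyclePoly_iff.1 h d hd)
  rw [Finsupp.weight_apply]
  exact Finset.sum_le_sum fun q _ => Nat.le_mul_of_pos_right _ q.1.pos

theorem evalCycles_smul {n : ℕ} (w : W G n) (c : k) (P : MvPolynomial (ℕ+ × ConjClasses G) k) :
    evalCycles w (c • P) = c * evalCycles w P := by
  rw [evalCycles, MvPolynomial.smul_eval]

end

/-- The function `eqCount u` is a polynomial in the cycle counts, by splitting off a cycle of `u`. -/
theorem exists_cyclePoly_eqCount [Finite G] (k : Type u) [Field k] {a : ℕ} (u : W G a) :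
    ∃ P ∈ cyclePoly G k a, ∀ (n : ℕ) (w : W G n), (eqCount u w : k) = evalCycles w P := by
  induction a using Nat.strong_induction_on with
  | _ a ih =>
  obtain _ | a := a
  · refine ⟨MvPolynomial.C 1, C_mem_cyclePoly 1, fun n w => ?_⟩
    have h1 : ∀ f f' : (FIG.of 0 : FIG G) ⟶ FIG.of n, f = f' := fun f f' =>
      hom_ext' (fun i => i.elim0) fun i => i.elim0
    let f₀ : (FIG.of 0 : FIG G) ⟶ FIG.of n := ⟨⟨fun i => i.elim0, fun i => i.elim0⟩, fun i => i.elim0⟩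
    have h2 : eqCount u w = 1 :=
      Nat.card_eq_one_iff_unique.2 ⟨⟨fun f f' => Subtype.ext (h1 _ _)⟩, ⟨f₀, h1 _ _⟩⟩
    rw [h2, evalCycles, MvPolynomial.eval_C, Nat.cast_one]
  · obtain ⟨b, l, u', h, f, g, hb, hf, hg, hdisj, hcov⟩ := exists_split u
    obtain ⟨P, hP, hPu⟩ := ih b (by omega) u'
    refine ⟨P * (((Nat.card {η : G // h * η = η * h} * (l + 1) : ℕ) : k) •
      MvPolynomial.X (l.succPNat, ConjClasses.mk h) - MvPolynomial.C (eqCount (stdCycle l h) u' : k)),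
      hb ▸ mul_mem_cyclePoly hP (sub_mem (Submodule.smul_mem _ _ (X_mem_cyclePoly _))
        (C_mem_cyclePoly _)), fun n w => ?_⟩
    have := congrArg (Nat.cast (R := k)) (eqCount_add_mul hf hg hdisj hcov w)
    rw [eqCount_stdCycle h w, Nat.cast_add, Nat.cast_mul, Nat.cast_mul, ← eq_sub_iff_add_eq,
      ← mul_sub, hPu n w, Nat.cast_mul _ (cycleCount w _ _)] at this
    rw [this, map_mul, map_sub, evalCycles_smul]
    simp only [evalCycles, MvPolynomial.eval_X, MvPolynomial.eval_C]
    rfl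

/-- The cycles of the identity are the fixed points, with trivial label. -/
theorem cycleCount_one (n : ℕ) (i : ℕ+) (C : ConjClasses G) [Decidable (i = 1 ∧ C = 1)] :
    cycleCount (1 : W G n) i C = if i = 1 ∧ C = 1 then n else 0 := by
  have hid : ⇑(1 : W G n).hom.emb = id := rfl
  have hper : ∀ x : Fin n, Function.minimalPeriod (1 : W G n).hom.emb x = 1 := fun x => by
    rw [hid]
    exact Function.minimalPeriod_id
  have hlab : ∀ x : Fin n, cycleLabel (1 : W G n) x = 1 := fun x => by
    change ConjClasses.mk (pathLabel 1 x (Function.minimalPeriod (1 : W G n).hom.emb x)) = 1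
    rw [hper, pathLabel_succ, pathLabel_zero, one_mul]
    rfl
  have h := card_eq_mul_cycleCount (1 : W G n) i.pos C
  simp only [hper, hlab] at h
  split_ifs with hi
  · obtain ⟨rfl, rfl⟩ := hi
    simpa using h.symm
  · have : Nat.card {x : Fin n // 1 = (i : ℕ) ∧ 1 = C} = 0 := by
      rw [Nat.card_eq_zero]
      exact Or.inl ⟨fun x => hi ⟨PNat.eq x.2.1.symm, x.2.2.symm⟩⟩
    rw [this] at h
    exact (Nat.mul_eq_zero.1 h.symm).resolve_left i.pos.ne'

/-- The value at the identity of `W_n` of a polynomial in the cycle counts is a polynomial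
in `n`. -/
theorem exists_polynomial_evalCycles_one {k : Type u} [Field k] {m : ℕ}
    {P : MvPolynomial (ℕ+ × ConjClasses G) k} (hP : P ∈ cyclePoly G k m) :
    ∃ p : Polynomial k, p.natDegree ≤ m ∧ ∀ n : ℕ, evalCycles (1 : W G n) P = p.eval (n : k) := by
  classical
  refine ⟨MvPolynomial.aeval (fun q : ℕ+ × ConjClasses G =>
    if q.1 = 1 ∧ q.2 = 1 then (Polynomial.X : Polynomial k) else 0) P, ?_, fun n => ?_⟩
  · have := MvPolynomial.aeval_natDegree_le (n := 1) P (totalDegree_le_of_mem_cyclePoly hP)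
      (fun q : ℕ+ × ConjClasses G =>
        if q.1 = 1 ∧ q.2 = 1 then (Polynomial.X : Polynomial k) else 0) fun q => by
          split_ifs
          · exact Polynomial.natDegree_X_le
          · simp
    simpa using this
  · have h : (Polynomial.evalRingHom (n : k)).comp (MvPolynomial.aeval (fun q : ℕ+ × ConjClasses G =>
        if q.1 = 1 ∧ q.2 = 1 then (Polynomial.X : Polynomial k) else 0)).toRingHom =
          evalCycles (1 : W G n) := by
      refine MvPolynomial.ringHom_ext (fun c => ?_) fun q => ?_
      · simp [evalCycles]
      · simp only [evalCycles, MvPolynomial.eval_X, cycleCount_one]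
        simp only [AlgHom.toRingHom_eq_coe, RingHom.coe_comp, RingHom.coe_coe,
          Function.comp_apply, MvPolynomial.aeval_X, Polynomial.coe_evalRingHom]
        split_ifs <;> simp
    exact (RingHom.congr_fun h P).symm

/-- At all natural numbers where a polynomial over a field of characteristic `0` takes a value
in the natural numbers, it agrees with a certain rational polynomial, obtained by projecting its
coefficients to `ℚ`. -/
theorem exists_rat_polynomial {k : Type*} [Field k] [CharZero k] (p : Polynomial k) :
    ∃ Q : Polynomial ℚ, Q.natDegree ≤ p.natDegree ∧
      ∀ n a : ℕ, (a : k) = p.eval (n : k) → (a : ℚ) = Q.eval (n : ℚ) := by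
  obtain ⟨φ, hφ⟩ : ∃ φ : k →ₗ[ℚ] ℚ, φ 1 = 1 := by
    obtain ⟨φ, hφ⟩ := (LinearMap.toSpanSingleton ℚ k 1).exists_leftInverse_of_injective
      (LinearMap.ker_eq_bot.2 fun a b hab => by simpa using hab)
    exact ⟨φ, by simpa using LinearMap.congr_fun hφ 1⟩
  have hφ' : ∀ (a : ℕ) (c : k), φ (a * c) = a * φ c := fun a c => by
    rw [← nsmul_eq_mul, map_nsmul, nsmul_eq_mul]
  refine ⟨∑ i ∈ Finset.range (p.natDegree + 1), Polynomial.monomial i (φ (p.coeff i)), ?_, ?_⟩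
  · refine Polynomial.natDegree_sum_le_of_forall_le _ _ fun i hi => ?_
    exact (Polynomial.natDegree_monomial_le _).trans (Nat.lt_succ_iff.1 (Finset.mem_range.1 hi))
  · intro n a h
    have h1 := hφ' a 1
    rw [mul_one, hφ, mul_one, h, Polynomial.eval_eq_sum_range, map_sum] at h1
    rw [← h1, Polynomial.eval_finsetSum]
    refine Finset.sum_congr rfl fun i _ => ?_
    rw [Polynomial.eval_monomial, mul_comm (p.coeff i), ← Nat.cast_pow, hφ']
    push_cast
    ring

end FIG

/-! ### Stable coefficients -/

/-- A combination `y = ∑ c_i b_i` of functions with values in the natural numbers that is orthogonal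
to all `b_j` vanishes. Over `ℚ` this is clear, as `∑ y ^ 2 = 0`; in general, the assumption passes
to the images of `y` under `ℚ`-linear functionals. -/
theorem sum_mul_natCast_eq_zero {k : Type*} [Field k] [CharZero k] {I Ω : Type*} [Fintype I]
    [Fintype Ω] (b : I → Ω → ℕ) (c : I → k)
    (h : ∀ j, ∑ w, (b j w : k) * ∑ i, c i * b i w = 0) (w : Ω) : ∑ i, c i * (b i w : k) = 0 := by
  refine (Module.forall_dual_apply_eq_zero_iff ℚ _).1 fun φ => ?_
  have hφ : ∀ (a : ℕ) (x : k), φ (a * x) = a * φ x := fun a x => by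
    rw [← nsmul_eq_mul, map_nsmul, nsmul_eq_mul]
  have hy : ∀ w, φ (∑ i, c i * (b i w : k)) = ∑ i, φ (c i) * b i w := fun w => by
    rw [map_sum]
    exact Finset.sum_congr rfl fun i _ => by rw [mul_comm, hφ, mul_comm]
  have horth : ∀ j, ∑ w, (b j w : ℚ) * ∑ i, φ (c i) * b i w = 0 := fun j => by
    rw [← map_zero φ, ← h j, map_sum]
    exact Finset.sum_congr rfl fun w _ => by rw [hφ, hy]
  have hsq : ∑ w, (∑ i, φ (c i) * (b i w : ℚ)) ^ 2 = 0 := by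
    calc ∑ w, (∑ i, φ (c i) * (b i w : ℚ)) ^ 2
        = ∑ j, φ (c j) * ∑ w, (b j w : ℚ) * ∑ i, φ (c i) * b i w := by
          simp only [sq, Finset.sum_mul _ _ (∑ i, _), Finset.mul_sum _ _ (φ _)]
          rw [Finset.sum_comm]
          exact Finset.sum_congr rfl fun j _ => Finset.sum_congr rfl fun w _ => mul_assoc _ _ _
      _ = 0 := by simp only [horth, mul_zero, Finset.sum_const_zero]
  rw [hy]
  exact pow_eq_zero_iff two_ne_zero |>.1
    ((Finset.sum_eq_zero_iff_of_nonneg fun w _ => sq_nonneg _).1 hsq w (Finset.mem_univ w))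

namespace FIGModule

open FIG Representation

variable {G k : Type u} [Group G] [Field k]

theorem exists_sum_of_mem_countSpan [Finite G] {s n : ℕ} {y : W G n → k}
    (h : y ∈ countSpan G k s n) :
    ∃ c : (Σ a : Fin (s + 1), W G a) → k, ∀ w, y w = ∑ p, c p * (eqCount p.2 w : k) := by
  obtain ⟨c, hc⟩ := (Submodule.mem_span_range_iff_exists_fun k).1 h
  refine ⟨c, fun w => ?_⟩
  rw [← hc, Finset.sum_apply]
  rfl

/-- The character of a module generated in degree `≤ s` is, for `n ≥ r + s`, a combination of the
functions `eqCount u` with coefficients that do not depend on `n`, if the steps between the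
coinvariants of `V ⊗ k[Hom([a], -)]` are injective from `r + a` on: the scalar products of the
character with the `eqCount u`, and those between the latter, do not depend on `n`. -/
theorem exists_coeff_character [Finite G] [CharZero k] (V : FIGModule G k)
    [∀ X, Module.Finite k (V.obj X)] {r s : ℕ} (hsr : s ≤ r) (hV : V.IsGeneratedInDegree s)
    (hi : ∀ a n, a ≤ s → r + a ≤ n → (V.ten a).StepInjective n) :
    ∃ c : (Σ a : Fin (s + 1), W G a) → k, ∀ n, r + s ≤ n → ∀ w : W G n,
      V.character n w = ∑ p, c p * (eqCount p.2 w : k) := by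
  obtain ⟨c, hc⟩ := exists_sum_of_mem_countSpan
    (V.character_mem_countSpan (fun n => inferInstance) hV (r + s))
  refine ⟨c, fun n hn => ?_⟩
  induction n, hn using Nat.le_induction with
  | base => exact hc
  | succ n hn ih =>
    obtain ⟨c', hc'⟩ := exists_sum_of_mem_countSpan
      (V.character_mem_countSpan (fun n => inferInstance) hV (n + 1))
    have hcard : ∀ l, (Fintype.card (W G l) : k) ≠ 0 := fun l =>
      Nat.cast_ne_zero.2 Fintype.card_ne_zero
    have hpair : ∀ q : Σ a : Fin (s + 1), W G a,
        (Fintype.card (W G (n + 1)) : k)⁻¹ * ∑ w, (eqCount q.2 w : k) * V.character (n + 1) w =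
          (Fintype.card (W G n) : k)⁻¹ * ∑ w, (eqCount q.2 w : k) * V.character n w := by
      intro q
      have hq : (q.1 : ℕ) ≤ s := Nat.lt_succ_iff.1 q.1.2
      exact sum_eqCount_mul_trace_succ V (𝟙 V) q.2 (stepSurjective_ten hV (by omega))
        (hi q.1 n hq (by omega))
    have hlin : ∀ (l : ℕ) (q : Σ a : Fin (s + 1), W G a),
        (Fintype.card (W G l) : k)⁻¹ * ∑ w : W G l, (eqCount q.2 w : k) *
          ∑ p, c p * (eqCount p.2 w : k) =
        ∑ p, c p * ((Fintype.card (W G l) : k)⁻¹ *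
          ∑ w : W G l, (eqCount q.2 w : k) * (eqCount p.2 w : k)) := by
      intro l q
      simp only [Finset.mul_sum]
      rw [Finset.sum_comm]
      exact Finset.sum_congr rfl fun p _ => Finset.sum_congr rfl fun w _ => by ring
    have hgram : ∀ q : Σ a : Fin (s + 1), W G a,
        ∑ w : W G (n + 1), (eqCount q.2 w : k) * V.character (n + 1) w =
          ∑ w : W G (n + 1), (eqCount q.2 w : k) * ∑ p, c p * (eqCount p.2 w : k) := by
      intro q
      refine mul_left_cancel₀ (inv_ne_zero (hcard (n + 1))) ?_
      rw [hpair, hlin]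
      simp only [ih]
      rw [hlin]
      refine Finset.sum_congr rfl fun p _ => ?_
      rw [sum_eqCount_mul_eqCount_succ (by omega)]
    have hdiff : ∀ w : W G (n + 1), V.character (n + 1) w - ∑ p, c p * (eqCount p.2 w : k) =
        ∑ p, (c' p - c p) * (eqCount p.2 w : k) := by
      intro w
      rw [hc', ← Finset.sum_sub_distrib]
      exact Finset.sum_congr rfl fun p _ => by ring
    let b : (Σ a : Fin (s + 1), W G a) → W G (n + 1) → ℕ := fun p w => eqCount p.2 w
    have horth : ∀ q, ∑ w, (b q w : k) * ∑ p, (c' p - c p) * (b p w : k) = 0 := by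
      intro q
      have h : ∀ w, (b q w : k) * ∑ p, (c' p - c p) * (b p w : k) =
          (eqCount q.2 w : k) * V.character (n + 1) w -
            (eqCount q.2 w : k) * ∑ p, c p * (eqCount p.2 w : k) := fun w => by
        rw [← mul_sub, hdiff]
      rw [Finset.sum_congr rfl fun w _ => h w, Finset.sum_sub_distrib, hgram, sub_self]
    intro w
    rw [← sub_eq_zero, hdiff]
    exact sum_mul_natCast_eq_zero b (fun p => c' p - c p) horth w

/-- The same as `exists_coeff_character`, in terms of cycle counts. -/
theorem exists_cyclePoly_character [Finite G] [CharZero k] (V : FIGModule G k)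
    [∀ X, Module.Finite k (V.obj X)] {r s : ℕ} (hsr : s ≤ r) (hV : V.IsGeneratedInDegree s)
    (hi : ∀ a n, a ≤ s → r + a ≤ n → (V.ten a).StepInjective n) :
    ∃ P ∈ cyclePoly G k s, ∀ n, r + s ≤ n → ∀ w : W G n, V.character n w = evalCycles w P := by
  obtain ⟨c, hc⟩ := V.exists_coeff_character hsr hV hi
  choose P hP hPu using fun p : Σ a : Fin (s + 1), W G a => exists_cyclePoly_eqCount k p.2
  refine ⟨∑ p, c p • P p, Submodule.sum_mem _ fun p _ => Submodule.smul_mem _ _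
    (cyclePoly_mono (Nat.lt_succ_iff.1 p.1.2) (hP p)), fun n hn w => ?_⟩
  rw [hc n hn, map_sum]
  exact Finset.sum_congr rfl fun p _ => by rw [evalCycles_smul, hPu]

/-- The character of an induced module is a polynomial in the cycle counts. -/
theorem exists_cyclePoly_character_ind [Finite G] [CharZero k] {d : ℕ} (A : Rep.{u} k (W G d))
    [Module.Finite k A] :
    ∃ P ∈ cyclePoly G k d, ∀ n, ∀ w : W G n, (ind A).character n w = evalCycles w P := by
  choose P hP hPu using fun u : W G d => exists_cyclePoly_eqCount k u
  refine ⟨(Fintype.card (W G d) : k)⁻¹ • ∑ u, LinearMap.trace k A (A.ρ u) • P u,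
    Submodule.smul_mem _ _ (Submodule.sum_mem _ fun u _ => Submodule.smul_mem _ _ (hP u)),
    fun n w => ?_⟩
  rw [evalCycles_smul, map_sum]
  refine (trace_ind_map A w).trans (congrArg _ (Finset.sum_congr rfl fun u _ => ?_))
  rw [evalCycles_smul, hPu, mul_comm]

end FIGModule

namespace FIGModule

open FIG Representation

variable {G k : Type u} [Group G] [Field k]

/-! ### Submodules generated in low degree -/

theorem IsFinitelyGenerated.finite [Finite G] {V : FIGModule G k} (hV : V.IsFinitelyGenerated)
    (X : FIG G) : Module.Finite k (V.obj X) := by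
  obtain ⟨S, hS, hgen⟩ := hV
  have := hS.to_subtype
  let g : (Σ p : S, ((FIG.of p.1.1 : FIG G) ⟶ FIG.of X.card)) → V.obj (FIG.of X.card) :=
    fun t => (V.map t.2).hom t.1.1.2
  refine ⟨Submodule.fg_def.2 ⟨Set.range g, Set.finite_range g, ?_⟩⟩
  rw [eq_top_iff]
  refine (hgen X.card).ge.trans (Submodule.span_mono ?_)
  rintro _ ⟨j, x, f, hx, rfl⟩
  exact ⟨⟨⟨⟨j, x⟩, hx⟩, f⟩, rfl⟩

theorem app_eq_zero_of_mem_generated {V B : FIGModule G k} (q : V ⟶ B) {s : ℕ}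
    (hB : ∀ j ≤ s, ∀ y : B.obj (FIG.of j), y = 0) {n : ℕ} {x : V.obj (FIG.of n)}
    (hx : x ∈ V.generated {p | p.1 ≤ s} n) : (q.app (FIG.of n)).hom x = 0 := by
  have : V.generated {p | p.1 ≤ s} n ≤ LinearMap.ker (q.app (FIG.of n)).hom := by
    refine Submodule.span_le.2 ?_
    rintro _ ⟨j, x, f, hj, rfl⟩
    rw [SetLike.mem_coe, LinearMap.mem_ker, naturality_apply, hB j hj ((q.app _).hom x), map_zero]
  exact this hx

theorem mem_generated_self (V : FIGModule G k) {s n : ℕ} (hn : n ≤ s) (x : V.obj (FIG.of n)) :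
    x ∈ V.generated {p | p.1 ≤ s} n :=
  Submodule.subset_span ⟨n, x, 𝟙 _, hn, by simp⟩

theorem map_mem_generated (V : FIGModule G k) {s : ℕ} {X Y : FIG G} (h : X ⟶ Y) {x : V.obj X}
    (hx : x ∈ V.generated {p | p.1 ≤ s} X.card) :
    (V.map h).hom x ∈ V.generated {p | p.1 ≤ s} Y.card := by
  have : V.generated {p | p.1 ≤ s} X.card ≤
      (V.generated {p | p.1 ≤ s} Y.card).comap (V.map h).hom := by
    refine Submodule.span_le.2 ?_
    rintro _ ⟨j, x, f, hj, rfl⟩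
    exact Submodule.subset_span ⟨j, x, f ≫ h, hj, (map_comp_apply V f h x).symm⟩
  exact this hx

/-- The submodule of `V` generated by the elements of degree `≤ s`. -/
noncomputable def low (V : FIGModule G k) (s : ℕ) : FIGModule G k where
  obj X := ModuleCat.of k (V.generated {p | p.1 ≤ s} X.card)
  map h := ModuleCat.ofHom ((V.map h).hom.restrict fun _ hx => map_mem_generated V h hx)
  map_id X := ModuleCat.hom_ext <| LinearMap.ext fun x => Subtype.ext <|
    LinearMap.congr_fun (congrArg ModuleCat.Hom.hom (V.map_id X)) x.1
  map_comp h h' := ModuleCat.hom_ext <| LinearMap.ext fun x => Subtype.ext <|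
    map_comp_apply V h h' x.1

/-- The inclusion of the submodule generated by the elements of degree `≤ s`. -/
noncomputable def lowIncl (V : FIGModule G k) (s : ℕ) : V.low s ⟶ V where
  app X := ModuleCat.ofHom (V.generated {p | p.1 ≤ s} X.card).subtype
  naturality _ _ _ := rfl

theorem lowIncl_injective (V : FIGModule G k) (s : ℕ) (X : FIG G) :
    Function.Injective ((V.lowIncl s).app X).hom :=
  Subtype.val_injective

theorem mem_range_lowIncl_iff (V : FIGModule G k) (s n : ℕ) (x : V.obj (FIG.of n)) :
    x ∈ LinearMap.range ((V.lowIncl s).app (FIG.of n)).hom ↔ x ∈ V.generated {p | p.1 ≤ s} n :=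
  iff_of_eq (congrArg (x ∈ ·) (Submodule.range_subtype (V.generated {p | p.1 ≤ s} n)))

theorem low_isGeneratedInDegree (V : FIGModule G k) (s : ℕ) : (V.low s).IsGeneratedInDegree s := by
  intro n
  rw [eq_top_iff]
  intro y _
  have h : V.generated {p | p.1 ≤ s} n ≤
      ((V.low s).generated {p | p.1 ≤ s} n).map ((V.lowIncl s).app (FIG.of n)).hom := by
    refine Submodule.span_le.2 ?_
    rintro _ ⟨j, x, f, hj, rfl⟩
    obtain ⟨x', rfl⟩ := (mem_range_lowIncl_iff V s j x).2 (mem_generated_self V hj x)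
    exact ⟨((V.low s).map f).hom x', Submodule.subset_span ⟨j, x', f, hj, rfl⟩,
      naturality_apply (V.lowIncl s) f x'⟩
  obtain ⟨y', hy', e⟩ := h ((mem_range_lowIncl_iff V s n _).1 ⟨y, rfl⟩)
  rwa [← lowIncl_injective V s _ e]

/-- The steps between the coinvariants of `V ⊗ k[Hom([a], -)]` are injective from `r + a` on if `V`
is related in degree `≤ r`. -/
theorem IsRelatedInDegree.stepInjective_ten [Finite G] {V : FIGModule G k} {r : ℕ}
    (hr : V.IsRelatedInDegree r) {a n : ℕ} (h : r + a ≤ n) : (V.ten a).StepInjective n := by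
  obtain ⟨K, M, i, p, -, hex, hp, hM, hK⟩ := hr
  exact StepInjective.of_exact (tenHom i (𝟙 _)) (tenHom p (𝟙 _)) (tenHom_exact i p a hex)
    (tenHom_surjective p a hp) (hM.stepInjective_ten a n) (stepSurjective_ten hK h)

/-! ### Splitting off the induced modules of high degree -/

section ind

variable {d : ℕ} {A : Rep.{u} k (W G d)}

theorem ind_eq_zero {n : ℕ} (h : n < d) (y : (ind A).obj (FIG.of n)) : y = 0 :=
  LinearMap.congr_fun (ind_hom_ext (L := LinearMap.id) (L' := 0) fun f _ =>
    absurd (card_le_of_hom f) (not_le.2 h)) y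

theorem imk_injective {X : FIG G} (f : (FIG.of d : FIG G) ⟶ X) : Function.Injective (imk A f) := by
  classical
  -- a left inverse: `f' ⊗ x` is sent to `u x` if `f' = u ≫ f`, and to `0` otherwise
  let φ : ((FIG.of d : FIG G) ⟶ X) → A →ₗ[k] A := fun f' =>
    if h : ∃ u : W G d, u.hom ≫ f = f' then A.ρ h.choose else 0
  have huniq : ∀ u v : W G d, u.hom ≫ f = v.hom ≫ f → u = v := fun u v h =>
    Iso.ext (cancel_right h)
  have hφ : ∀ u : W G d, φ (u.hom ≫ f) = A.ρ u := by
    intro u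
    have h : ∃ v : W G d, v.hom ≫ f = u.hom ≫ f := ⟨u, rfl⟩
    simp only [φ, dif_pos h]
    rw [huniq _ _ h.choose_spec]
  obtain ⟨L, hL⟩ := ind_exists_lift φ <| by
    intro f' w x
    by_cases h : ∃ u : W G d, u.hom ≫ f = f'
    · obtain ⟨u, rfl⟩ := h
      have : w.hom ≫ u.hom ≫ f = (u * w).hom ≫ f := by rw [mul_hom, Category.assoc]
      rw [this, hφ, hφ, map_mul]
      rfl
    · have h' : ¬ ∃ u : W G d, u.hom ≫ f = w.hom ≫ f' := by
        rintro ⟨u, hu⟩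
        refine h ⟨u * w⁻¹, ?_⟩
        rw [mul_hom, inv_hom, Category.assoc, hu, aut_inv_hom_assoc]
      simp only [φ, dif_neg h, dif_neg h', LinearMap.zero_apply]
  refine Function.LeftInverse.injective (g := L) fun x => ?_
  have h1 := hφ 1
  rw [one_hom, Category.id_comp, map_one] at h1
  rw [hL, h1]
  rfl

theorem app_mem_generated_of_ind {V : FIGModule G k} (e : ind A ⟶ V) {s : ℕ} (h : d ≤ s) {n : ℕ}
    (z : (ind A).obj (FIG.of n)) : (e.app (FIG.of n)).hom z ∈ V.generated {p | p.1 ≤ s} n := by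
  have : (V.generated {p | p.1 ≤ s} n).mkQ ∘ₗ (e.app (FIG.of n)).hom = 0 := by
    refine ind_hom_ext fun f x => (Submodule.Quotient.mk_eq_zero _).2 ?_
    have h1 := ind_map_imk A f (𝟙 _) x
    rw [Category.id_comp] at h1
    rw [← h1, naturality_apply]
    exact Submodule.subset_span ⟨d, _, f, h, rfl⟩
  exact (Submodule.Quotient.mk_eq_zero _).1 (LinearMap.congr_fun this z)

end ind

/-- A map of `FI_G`-modules that vanishes on the kernel of `p : M → V` factors through `p`. -/
theorem exists_desc {K M V B : FIGModule G k} (i : K ⟶ M) (p : M ⟶ V)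
    (hex : ∀ X, Function.Exact (i.app X).hom (p.app X).hom)
    (hp : ∀ X, Function.Surjective (p.app X).hom) (c : M ⟶ B)
    (hc : ∀ X x, (c.app X).hom ((i.app X).hom x) = 0) :
    ∃ q : V ⟶ B, ∀ X x, (q.app X).hom ((p.app X).hom x) = (c.app X).hom x := by
  choose σ hσ using fun X => (p.app X).hom.exists_rightInverse_of_surjective
    (LinearMap.range_eq_top.2 (hp X))
  have hq : ∀ X x, (c.app X).hom (σ X ((p.app X).hom x)) = (c.app X).hom x := by
    intro X x
    have h1 : (p.app X).hom (σ X ((p.app X).hom x) - x) = 0 := by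
      rw [map_sub, sub_eq_zero]
      exact LinearMap.congr_fun (hσ X) _
    obtain ⟨t, ht⟩ := (hex X _).1 h1
    rw [← sub_eq_zero, ← map_sub, ← ht, hc]
  refine ⟨{ app X := ModuleCat.ofHom ((c.app X).hom ∘ₗ σ X), naturality X Y h := ?_ }, hq⟩
  refine ModuleCat.hom_ext (LinearMap.ext fun x => ?_)
  obtain ⟨x, rfl⟩ := hp X x
  change (c.app Y).hom (σ Y ((V.map h).hom _)) = (B.map h).hom ((c.app X).hom (σ X _))
  rw [← naturality_apply, hq, hq, naturality_apply]

/-- The components of the elements of a direct sum of `FI_G`-modules. -/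
theorem exists_components {M : FIGModule G k} {ι : Type u} [DecidableEq ι] {N : ι → FIGModule G k}
    (j : ∀ a, N a ⟶ M)
    (hj : ∀ X, Function.Bijective
      (DirectSum.toModule k ι (M.obj X) fun a => ((j a).app X).hom)) (a : ι) :
    ∃ c : M ⟶ N a, (∀ X x, (c.app X).hom (((j a).app X).hom x) = x) ∧
      ∀ b, b ≠ a → ∀ X x, (c.app X).hom (((j b).app X).hom x) = 0 := by
  let φ (X : FIG G) (b : ι) : (N b).obj X →ₗ[k] (N a).obj X :=
    Pi.single (M := fun b => (N b).obj X →ₗ[k] (N a).obj X) a LinearMap.id b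
  have h1 : ∀ X, φ X a = LinearMap.id := fun X => Pi.single_eq_same _ _
  have h0 : ∀ X b, b ≠ a → φ X b = 0 := fun X b hb => Pi.single_eq_of_ne hb _
  choose L hL using fun X => exists_lift_of_bijective_toModule (hj X) (φ X)
  refine ⟨{ app X := ModuleCat.ofHom (L X), naturality X Y h := ?_ }, fun X x => ?_,
    fun b hb X x => ?_⟩
  · refine ModuleCat.hom_ext (hom_ext_of_bijective_toModule (hj X) fun b x => ?_)
    change L Y ((M.map h).hom (((j b).app X).hom x)) = ((N a).map h).hom (L X (((j b).app X).hom x))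
    rw [← naturality_apply, hL, hL]
    by_cases hb : b = a
    · subst hb
      rw [h1, h1]
      rfl
    · rw [h0 _ _ hb, h0 _ _ hb]
      exact (map_zero _).symm
  · change L X _ = x
    rw [hL, h1]
    rfl
  · change L X _ = 0
    rw [hL, h0 _ _ hb]
    rfl

/-- The character of a direct sum. The summand `U` is given only by its inclusion into `V`. -/
theorem character_eq_add_sum {V U : FIGModule G k} (j : U ⟶ V)
    (hj : ∀ X, Function.Injective (j.app X).hom) {I : Type*} [Fintype I] {N : I → FIGModule G k}
    (e : ∀ a, N a ⟶ V) (q : ∀ a, V ⟶ N a) {n : ℕ}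
    (hqe : ∀ a x, ((q a).app (FIG.of n)).hom (((e a).app (FIG.of n)).hom x) = x)
    (hqj : ∀ a x, ((q a).app (FIG.of n)).hom ((j.app (FIG.of n)).hom x) = 0)
    (hrange : ∀ x, x - ∑ a, ((e a).app (FIG.of n)).hom (((q a).app (FIG.of n)).hom x) ∈
      LinearMap.range (j.app (FIG.of n)).hom)
    [Module.Finite k (V.obj (FIG.of n))] (w : W G n) :
    V.character n w = U.character n w + ∑ a, (N a).character n w := by
  have hUfin : Module.Finite k (U.obj (FIG.of n)) := Module.Finite.of_injective _ (hj (FIG.of n))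
  have hNfin : ∀ a, Module.Finite k ((N a).obj (FIG.of n)) := fun a =>
    Module.Finite.of_surjective ((q a).app (FIG.of n)).hom fun x => ⟨_, hqe a x⟩
  let R : V.obj (FIG.of n) →ₗ[k] V.obj (FIG.of n) :=
    LinearMap.id - ∑ a, ((e a).app (FIG.of n)).hom ∘ₗ ((q a).app (FIG.of n)).hom
  have hR : ∀ x, R x = x - ∑ a, ((e a).app (FIG.of n)).hom (((q a).app (FIG.of n)).hom x) :=
    fun x => by simp [R]
  let π : V.obj (FIG.of n) →ₗ[k] U.obj (FIG.of n) :=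
    (LinearEquiv.ofInjective _ (hj (FIG.of n))).symm.toLinearMap ∘ₗ
      R.codRestrict _ fun x => by rw [hR]; exact hrange x
  have hπ : ∀ x, (j.app (FIG.of n)).hom (π x) = R x := fun x =>
    congrArg Subtype.val ((LinearEquiv.ofInjective _ (hj (FIG.of n))).apply_symm_apply _)
  have hid : LinearMap.id = (j.app (FIG.of n)).hom ∘ₗ π +
      ∑ a, ((e a).app (FIG.of n)).hom ∘ₗ ((q a).app (FIG.of n)).hom := by
    refine LinearMap.ext fun x => ?_
    rw [LinearMap.add_apply, LinearMap.comp_apply, hπ, hR, LinearMap.sum_apply]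
    exact (sub_add_cancel _ _).symm
  have hU : (π ∘ₗ (V.map w.hom).hom) ∘ₗ (j.app (FIG.of n)).hom = (U.map w.hom).hom := by
    refine LinearMap.ext fun x => hj _ ?_
    rw [LinearMap.comp_apply, LinearMap.comp_apply, hπ, ← naturality_apply, hR,
      Finset.sum_eq_zero fun a _ => by rw [hqj, map_zero], sub_zero]
  have hN : ∀ a, (((q a).app (FIG.of n)).hom ∘ₗ (V.map w.hom).hom) ∘ₗ ((e a).app (FIG.of n)).hom =
      ((N a).map w.hom).hom := by
    refine fun a => LinearMap.ext fun x => ?_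
    rw [LinearMap.comp_apply, LinearMap.comp_apply, ← naturality_apply, hqe]
  have hsplit : (V.map w.hom).hom = (j.app (FIG.of n)).hom ∘ₗ (π ∘ₗ (V.map w.hom).hom) +
      ∑ a, ((e a).app (FIG.of n)).hom ∘ₗ (((q a).app (FIG.of n)).hom ∘ₗ (V.map w.hom).hom) := by
    refine LinearMap.ext fun x => ?_
    have := LinearMap.congr_fun hid ((V.map w.hom).hom x)
    simpa only [LinearMap.add_apply, LinearMap.sum_apply, LinearMap.comp_apply,
      LinearMap.id_apply] using this
  rw [character, hsplit, map_add, map_sum, LinearMap.trace_comp_comm', hU]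
  refine congrArg₂ _ rfl (Finset.sum_congr rfl fun a _ => ?_)
  rw [LinearMap.trace_comp_comm', hN]
  rfl

end FIGModule

namespace FIGModule

open FIG Representation

variable {G k : Type u} [Group G] [Field k]

/-- A module that is generated in degree `≤ m` and related in degree `≤ r` is, up to its submodule
generated in degree `≤ r`, a finite direct sum of induced modules of representations of groups
`W_d` with `r < d ≤ m`: the relations do not involve the summands `ind A` of the relatively projective
module `M` with `d > r`, because those vanish in degrees `≤ r`. -/
theorem IsRelatedInDegree.exists_ind_summands [Finite G] {V : FIGModule G k}
    [∀ X, Module.Finite k (V.obj X)] {m r : ℕ} (hm : V.IsGeneratedInDegree m)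
    (hr : V.IsRelatedInDegree r) :
    ∃ (I : Type u) (_ : Fintype I) (d : I → ℕ) (A : ∀ a, Rep.{u} k (W G (d a)))
      (e : ∀ a, ind (A a) ⟶ V) (q : ∀ a, V ⟶ ind (A a)),
      (∀ a, r < d a ∧ d a ≤ m ∧ Module.Finite k (A a)) ∧
      (∀ a X x, ((q a).app X).hom (((e a).app X).hom x) = x) ∧
      ∀ n x, x - ∑ a, ((e a).app (FIG.of n)).hom (((q a).app (FIG.of n)).hom x) ∈
        V.generated {p | p.1 ≤ r} n := by
  classical
  obtain ⟨K, M, i, p, -, hex, hp, ⟨ι, d, A, j, hj⟩, hK⟩ := hr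
  choose c hc hc' using exists_components j hj
  let I := {a : ι // r < d a ∧ Nontrivial (A a)}
  have hq : ∀ a : I, ∃ q : V ⟶ ind (A a.1), ∀ X x,
      (q.app X).hom ((p.app X).hom x) = ((c a.1).app X).hom x := fun a =>
    exists_desc i p hex hp (c a.1) fun X x => app_eq_zero_of_mem_generated (i ≫ c a.1)
      (fun l hl y => ind_eq_zero (hl.trans_lt a.2.1) y)
      ((hK X.card).symm ▸ Submodule.mem_top : x ∈ K.generated {p | p.1 ≤ r} X.card)
  choose q hqp using hq
  let e (a : I) : ind (A a.1) ⟶ V := j a.1 ≫ p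
  have he : ∀ a X x, ((e a).app X).hom x = (p.app X).hom (((j a.1).app X).hom x) := fun a X x => rfl
  have hqe : ∀ a X x, ((q a).app X).hom (((e a).app X).hom x) = x := fun a X x => by
    rw [he, hqp, hc]
  have hqe' : ∀ (a : I) b, b ≠ a.1 → ∀ X x,
      ((q a).app X).hom ((p.app X).hom (((j b).app X).hom x)) = 0 := fun a b hb X x => by
    rw [hqp, hc' _ _ hb]
  have hdm : ∀ a : I, d a.1 ≤ m := by
    intro a
    by_contra! h
    obtain ⟨x, hx⟩ := (nontrivial_iff_exists_ne (0 : A a.1)).1 a.2.2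
    refine hx (imk_injective (𝟙 (FIG.of (d a.1))) ?_)
    rw [map_zero, ← hqe a _ (imk (A a.1) (𝟙 _) x)]
    exact app_eq_zero_of_mem_generated (q a) (fun l hl y => ind_eq_zero (hl.trans_lt h) y)
      ((hm _).symm ▸ Submodule.mem_top)
  have hAfin : ∀ a : I, Module.Finite k (A a.1) := by
    intro a
    have h1 : Module.Finite k ((ind (A a.1)).obj (FIG.of (d a.1))) :=
      Module.Finite.of_surjective ((q a).app _).hom fun x => ⟨_, hqe a _ x⟩
    exact Module.Finite.of_injective (imk (A a.1) (𝟙 (FIG.of (d a.1)))) (imk_injective _)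
  -- each of the summands contributes a nonzero vector in degree `m`
  have hx : ∀ a : I, ∃ x : (ind (A a.1)).obj (FIG.of m), x ≠ 0 := by
    intro a
    obtain ⟨x, hx⟩ := (nontrivial_iff_exists_ne (0 : A a.1)).1 a.2.2
    let f : (FIG.of (d a.1) : FIG G) ⟶ FIG.of m := ⟨Fin.castLEEmb (hdm a), fun _ => 1⟩
    exact ⟨imk (A a.1) f x, fun h => hx (imk_injective f (h.trans (map_zero _).symm))⟩
  choose x hx using hx
  have hlin : LinearIndependent k fun a : I => ((e a).app (FIG.of m)).hom (x a) := by
    rw [linearIndependent_iff']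
    intro s g hg b hb
    have h1 := congrArg ((q b).app (FIG.of m)).hom hg
    rw [map_sum, map_zero, Finset.sum_eq_single_of_mem b hb, map_smul, hqe] at h1
    · exact (smul_eq_zero.1 h1).resolve_right (hx b)
    · intro a _ hab
      rw [map_smul, he, hqe' b a.1 fun h => hab (Subtype.ext h), smul_zero]
  have hI : Finite I := hlin.finite_of_isNoetherian
  refine ⟨I, Fintype.ofFinite I, fun a => d a.1, fun a => A a.1, e, q,
    fun a => ⟨a.2.1, hdm a, hAfin a⟩, hqe, fun n y => ?_⟩
  have := Fintype.ofFinite I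
  let R : V.obj (FIG.of n) →ₗ[k] V.obj (FIG.of n) :=
    LinearMap.id - ∑ a : I, ((e a).app (FIG.of n)).hom ∘ₗ ((q a).app (FIG.of n)).hom
  have hR : ∀ y, R y = y - ∑ a : I, ((e a).app (FIG.of n)).hom (((q a).app (FIG.of n)).hom y) :=
    fun y => by simp [R]
  let N := V.generated {p | p.1 ≤ r} n
  have hzero : (N.mkQ ∘ₗ R) ∘ₗ (p.app (FIG.of n)).hom = 0 := by
    refine hom_ext_of_bijective_toModule (hj (FIG.of n)) fun b z =>
      (Submodule.Quotient.mk_eq_zero _).2 ?_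
    rw [hR]
    by_cases hb : r < d b
    · by_cases hA : Nontrivial (A b)
      · let b' : I := ⟨b, hb, hA⟩
        rw [Finset.sum_eq_single b' (fun a _ hab => by
            rw [hqe' a b fun h => hab (Subtype.ext h.symm), map_zero]) (by simp)]
        change (p.app _).hom _ - ((e b').app _).hom (((q b').app _).hom (((e b').app _).hom z)) ∈ N
        rw [hqe, he, sub_self]
        exact zero_mem N
      · rw [not_nontrivial_iff_subsingleton] at hA
        have hz : z = 0 := LinearMap.congr_fun (ind_hom_ext (L := LinearMap.id) (L' := 0)
          fun f x => by rw [Subsingleton.elim x 0, map_zero, map_zero, map_zero]) z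
        rw [hz]
        simp only [map_zero, Finset.sum_const_zero, sub_zero]
        exact zero_mem N
    · rw [Finset.sum_eq_zero fun a _ => by
        rw [hqe' a b fun h => hb (h ▸ a.2.1), map_zero], sub_zero]
      exact app_mem_generated_of_ind (j b ≫ p) (not_lt.1 hb) z
  obtain ⟨y, rfl⟩ := hp _ y
  have h1 := (Submodule.Quotient.mk_eq_zero _).1 (LinearMap.congr_fun hzero y)
  change R ((p.app (FIG.of n)).hom y) ∈ N at h1
  rw [hR] at h1
  convert h1

/-! ### Polynomial characters -/

/-- The character of a module that is generated in degree `≤ m` and related in degree `≤ r` is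
a polynomial of degree `≤ m` in the cycle counts, for `n ≥ r + min m r`. -/
theorem IsRelatedInDegree.exists_cyclePoly_character [Finite G] [CharZero k] {V : FIGModule G k}
    [∀ X, Module.Finite k (V.obj X)] {m r : ℕ} (hm : V.IsGeneratedInDegree m)
    (hr : V.IsRelatedInDegree r) :
    ∃ P ∈ cyclePoly G k m, ∀ n, r + min m r ≤ n → ∀ w : W G n,
      V.character n w = evalCycles w P := by
  obtain ⟨I, _, d, A, e, q, hA, hqe, hrange⟩ := hr.exists_ind_summands hm
  let s := min m r
  have hfin : ∀ X, Module.Finite k ((V.low s).obj X) := fun X =>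
    Module.Finite.of_injective _ (lowIncl_injective V s X)
  obtain ⟨P, hP, hPU⟩ := (V.low s).exists_cyclePoly_character (min_le_right m r)
    (V.low_isGeneratedInDegree s) fun a n _ hn =>
      (hr.stepInjective_ten hn).of_injective (tenHom (V.lowIncl s) (𝟙 _))
        (tenHom_injective _ a (lowIncl_injective V s))
  have hind : ∀ a, ∃ P ∈ cyclePoly G k (d a), ∀ n, ∀ w : W G n,
      (ind (A a)).character n w = evalCycles w P := fun a =>
    have := (hA a).2.2
    exists_cyclePoly_character_ind (A a)
  choose P' hP' hPA using hind
  refine ⟨P + ∑ a, P' a, add_mem (cyclePoly_mono (min_le_left m r) hP)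
    (Submodule.sum_mem _ fun a _ => cyclePoly_mono (hA a).2.1 (hP' a)), fun n hn w => ?_⟩
  rw [character_eq_add_sum (V.lowIncl s) (lowIncl_injective V s) e q (fun a x => hqe a _ x)
    (fun a x => ?_) (fun x => ?_) w, hPU n hn, map_add, map_sum]
  · simp only [hPA]
  · exact app_eq_zero_of_mem_generated (q a)
      (fun l hl y => ind_eq_zero (lt_of_le_of_lt (hl.trans (min_le_right m r)) (hA a).1) y)
      ((mem_range_lowIncl_iff V s n _).1 ⟨x, rfl⟩)
  · rw [mem_range_lowIncl_iff]
    rcases le_total m r with h | h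
    · rw [show s = m from min_eq_left h, hm n]
      exact Submodule.mem_top
    · rw [show s = r from min_eq_right h]
      exact hrange n x

end FIGModule

theorem mainTheorem1 {G k : Type u} [Group G] [Finite G] [Field k] [CharZero k]
    (hk : IsSplittingFieldOfGroup k G) (V : FIGModule G k) (m r : ℕ)
    (hfg : V.IsFinitelyGenerated) (hm : V.IsGeneratedInDegree m)
    (hr : V.IsRelatedInDegree r) :
    (∀ n : ℕ, Module.Finite k (V.obj (FIG.of n))) ∧
    (∃ P : MvPolynomial (ℕ+ × ConjClasses G) k,
      MvPolynomial.weightedTotalDegree (fun q : ℕ+ × ConjClasses G => (q.1 : ℕ)) P ≤ m ∧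
      P.totalDegree ≤ m ∧
      ∀ n : ℕ, r + min m r ≤ n → ∀ w : FIG.W G n,
        V.character n w =
          MvPolynomial.eval
            (fun q : ℕ+ × ConjClasses G => (FIG.cycleCount w (q.1 : ℕ) q.2 : k)) P) ∧
    (∃ Q : Polynomial ℚ, Q.natDegree ≤ m ∧
      ∀ n : ℕ, r + min m r ≤ n →
        (Module.finrank k (V.obj (FIG.of n)) : ℚ) = Q.eval (n : ℚ)) := by
  have hfin := hfg.finite
  obtain ⟨P, hP, hPV⟩ := hr.exists_cyclePoly_character hm
  obtain ⟨p, hp, hpP⟩ := FIG.exists_polynomial_evalCycles_one hP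
  obtain ⟨Q, hQ, hQp⟩ := FIG.exists_rat_polynomial p
  refine ⟨fun n => hfin _, ⟨P, FIG.weightedTotalDegree_le_of_mem_cyclePoly hP,
    FIG.totalDegree_le_of_mem_cyclePoly hP, hPV⟩, Q, hQ.trans hp, fun n hn => hQp _ _ ?_⟩
  have h1 : V.character n 1 = Module.finrank k (V.obj (FIG.of n)) := by
    rw [← LinearMap.trace_id]
    exact congrArg (LinearMap.trace k _) (V.map_id_hom (FIG.of n))
  rw [← h1, hPV n hn, hpP]
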